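/- \textbf{Theorem (Twinned lollipop at an interior vertex of the path part).} A composition $I=i_1i_2\dotsm i_r\vDash n$ is a sequence of positive integers with sum $n$; write $\ell(I)=r$ for its length, $i_{-k}=i_{r+1-k}$ for its $k$th last part, $I\backslash i_{-1}=i_1\dotsm i_{r-1}$, and $e_I=e_{i_1}e_{i_2}\dotsm e_{i_r}$ for the product of elementary symmetric functions. Let $w_I=i_1(i_2-1)(i_3-1)\dotsm(i_r-1)$ and, for $0\le b\le n$, \[ \Theta_I(b)=\min\{i_1+\dots+i_k\colon 0\le k\le \ell(I),\ i_1+\dots+i_k\ge b\}-b . \] For a finite simple graph $G$, let $X_G=\sum_\kappa\prod_{v\in V(G)}x_{\kappa(v)}$ be its chromatic symmetric function, where $\kappa$ runs over the proper colorings of $G$ by positive integers. The lollipop $K_a^l$ is obtained from the complete graph $K_a$ by attaching a path of length $l$ at one of its vertices. For $1\le h\le l-1$, the twinned lollipop $\mathrm{tw}_h(K_a^l)$ is obtained from $K_a^l$ by adding a new vertex and joining it to $v^*$ and to all neighbours of $v^*$, where $v^*$ is the vertex of the path at distance $h$ from the leaf end of the path. Let $n=a+l+1$, where $a\ge 1$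 and $l\ge 2$. For any $1\le h\le l-1$, \begin{align*} \frac{X_{\mathrm{tw}_h(K_a^l)}}{2(a-1)!} &=\sum_{\substack{K\vDash n,\ k_{-1}\ge a\\ \Theta_K(h)\ge 3}} 2w_Ke_K +\sum_{\substack{I\vDash n-1,\ i_{-1}\ge a\\ \Theta_I(h)\ge 3}} w_I\,e_1e_I +\sum_{\substack{K\vDash n,\ \Theta_K(h)\le 1,\ k_{-1}\ge 3\\ k_{-1}+k_{-2}\ge n-h+1\text{ or }k_{-2}\ge a}}(k_{-1}-2)\,w_{K\backslash k_{-1}}e_K\\ &\quad+\sum_{\substack{K\vDash n,\ k_{-1}\ge a\\ \Theta_K(h)=2,\ \Theta_K(h+3)\ge 2}}\frac{\Theta_K(h+3)-1}{\Theta_K(h+3)}\,w_Ke_K , \end{align*} and every coefficient that occurs on the right-hand side is nonnegative. (Every composition $K$ in the third sum has at least two parts, so $k_{-2}$ is defined there.) -/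

import Mathlib

open scoped Nat

namespace TwinnedLollipop

/-! ### Graphs -/

/-- The lollipop graph `K_a^l`, for `1 ≤ a`: a clique `K_a` with a path of length `l` attached at one
of its vertices. The clique consists of the vertices `l, …, l + a - 1`, the path is
`0 — 1 — ⋯ — l`, its leaf end is the vertex `0`, and the vertex `h ≤ l` of the path has distance `h`
from that end. -/
def lollipop (a l : ℕ) : SimpleGraph (Fin (a + l)) where
  Adj i j := i ≠ j ∧
    ((l ≤ (i : ℕ) ∧ l ≤ (j : ℕ)) ∨ (i : ℕ) + 1 = (j : ℕ) ∨ (j : ℕ) + 1 = (i : ℕ))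
  symm := ⟨by
    rintro i j ⟨hne, h⟩
    exact ⟨hne.symm, by tauto⟩⟩
  loopless := ⟨fun i h => h.1 rfl⟩

/-- The twin of the rooted graph `(G, v)`: a new vertex (`none`) is added and connected
with `v` and with all neighbours of `v`. -/
def twin {V : Type*} (G : SimpleGraph V) (v : V) : SimpleGraph (Option V) where
  Adj
    | some x, some y => G.Adj x y
    | some x, none => x = v ∨ G.Adj v x
    | none, some y => y = v ∨ G.Adj v y
    | none, none => False
  symm := ⟨by
    rintro (_ | x) (_ | y) h
    · exact h
    · exact h
    · exact h
    · exact G.adj_symm h⟩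
  loopless := ⟨by
    rintro (_ | x) h
    · exact h
    · exact G.loopless.irrefl x h⟩

/-- The twinned lollipop `tw_h(K_a^l)`: the twin of `K_a^l` at the vertex of its path part
at distance `h` from the leaf. -/
def twinnedLollipop (a l h : ℕ) (hh : h < l) : SimpleGraph (Option (Fin (a + l))) :=
  twin (lollipop a l) ⟨h, by omega⟩

/-! ### Symmetric functions, as formal power series in `x_0, x_1, x_2, …` over `ℚ` -/

/-- The chromatic symmetric function `X_G = ∑_κ ∏_v x_{κ(v)}`, where `κ` runs over the proper
colorings of the finite graph `G` by the indices of the variables. The coefficient of a monomial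
`x^m` is the number of proper colorings `κ` with `∏_v x_{κ(v)} = x^m`. -/
noncomputable def chromaticSymm {V : Type*} [Fintype V] (G : SimpleGraph V) :
    MvPowerSeries ℕ ℚ :=
  fun m => (Nat.card {κ : G.Coloring ℕ // ∑ v, Finsupp.single (κ v) 1 = m} : ℚ)

/-- The elementary symmetric function `e_k = ∑_{i_1 < ⋯ < i_k} x_{i_1} ⋯ x_{i_k}`. The coefficient
of a monomial `x^m` is the number of `k`-element sets `S` of indices with `∏_{i ∈ S} x_i = x^m`. -/
noncomputable def elemSymm (k : ℕ) : MvPowerSeries ℕ ℚ :=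
  fun m => (Nat.card {S : Finset ℕ // S.card = k ∧ ∑ i ∈ S, Finsupp.single i 1 = m} : ℚ)

/-- `e_I = e_{i_1} e_{i_2} ⋯` for a finite sequence `I = i_1 i_2 ⋯`. -/
noncomputable def elemSymmList (I : List ℕ) : MvPowerSeries ℕ ℚ :=
  (I.map elemSymm).prod

/-! ### Functions on compositions -/

/-- `w_I = i_1 (i_2 - 1) (i_3 - 1) ⋯ (i_l - 1)`. -/
def w : List ℕ → ℚ
  | [] => 1
  | i :: I => (i : ℚ) * (I.map fun j => (j : ℚ) - 1).prod

/-- `last I k` is the `k`th last part `i_{-k}` of `I`, for `1 ≤ k ≤ ℓ(I)`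
(and `0` for `k > ℓ(I)`). -/
def last {n : ℕ} (I : Composition n) (k : ℕ) : ℕ :=
  I.blocks.reverse.getD (k - 1) 0

/-- `σ_I(a)`, for `0 ≤ a ≤ n`: the least partial sum `i_1 + ⋯ + i_k` with `0 ≤ k ≤ ℓ(I)`
that is at least `a`. -/
noncomputable def σ {n : ℕ} (I : Composition n) (a : ℕ) : ℕ :=
  sInf {s | ∃ k ≤ I.length, I.sizeUpTo k = s ∧ a ≤ s}

/-- `Θ_I(a) = σ_I(a) - a ≥ 0`, for `0 ≤ a ≤ n`. -/
noncomputable def Θ {n : ℕ} (I : Composition n) (a : ℕ) : ℕ :=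
  σ I a - a

end TwinnedLollipop

open TwinnedLollipop

namespace TwinnedLollipop

/-! ### Compositions as lists -/

/-- The compositions of `n`, as lists of positive integers. -/
def comps (n : ℕ) : Finset (List ℕ) :=
  (Finset.univ : Finset (Composition n)).image Composition.blocks

theorem mem_comps {n : ℕ} {c : List ℕ} : c ∈ comps n ↔ (∀ i ∈ c, 0 < i) ∧ c.sum = n := by
  simp only [comps, Finset.mem_image, Finset.mem_univ, true_and]
  constructor
  · rintro ⟨K, rfl⟩
    exact ⟨fun i hi => K.blocks_pos hi, K.blocks_sum⟩
  · rintro ⟨h1, h2⟩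
    exact ⟨⟨c, fun {i} hi => h1 i hi, h2⟩, rfl⟩

theorem sum_composition_filter {M : Type*} [AddCommMonoid M] {n : ℕ} (p : List ℕ → Prop)
    [DecidablePred p] (q : Composition n → Prop) [DecidablePred q]
    (hq : ∀ K : Composition n, q K ↔ p K.blocks) (f : List ℕ → M) :
    ∑ K : Composition n with q K, f K.blocks = ∑ c ∈ comps n with p c, f c := by
  refine Finset.sum_bij (fun K _ => K.blocks) ?_ ?_ ?_ ?_
  · intro K hK
    simp only [Finset.mem_filter, Finset.mem_univ, true_and] at hK
    simp only [Finset.mem_filter]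
    exact ⟨Finset.mem_image_of_mem _ (Finset.mem_univ K), (hq K).1 hK⟩
  · intro K _ K' _ h
    exact Composition.ext h
  · intro c hc
    simp only [Finset.mem_filter, comps, Finset.mem_image, Finset.mem_univ, true_and] at hc
    obtain ⟨⟨K, rfl⟩, h⟩ := hc
    exact ⟨K, by simpa using (hq K).2 h, rfl⟩
  · intro K _
    rfl

theorem ne_nil_of_mem_comps {n : ℕ} {c : List ℕ} (hc : c ∈ comps n) (hn : 0 < n) : c ≠ [] := by
  rintro rfl
  simp [mem_comps] at hc
  omega

theorem comps_zero : comps 0 = {[]} := by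
  ext c
  rw [mem_comps, Finset.mem_singleton]
  constructor
  · rintro ⟨h1, h2⟩
    rcases c with _ | ⟨b, c⟩
    · rfl
    · have := h1 b (by simp)
      simp at h2
      omega
  · rintro rfl
    simp

theorem append_mem_comps {m k : ℕ} {A B : List ℕ} (hA : A ∈ comps m) (hB : B ∈ comps k) :
    A ++ B ∈ comps (m + k) := by
  rw [mem_comps] at *
  refine ⟨fun i hi => ?_, by simp [hA.2, hB.2]⟩
  rcases List.mem_append.1 hi with h | h
  exacts [hA.1 i h, hB.1 i h]

/-- `s` is a partial sum of `c`. -/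
def IsPartialSum (c : List ℕ) (s : ℕ) : Prop :=
  ∃ A B, c = A ++ B ∧ A.sum = s

theorem append_inj_of_sum {A A' B B' : List ℕ} (hA : ∀ i ∈ A, 0 < i) (hA' : ∀ i ∈ A', 0 < i)
    (hs : A.sum = A'.sum) (h : A ++ B = A' ++ B') : A = A' ∧ B = B' := by
  induction A generalizing A' with
  | nil =>
    rcases A' with _ | ⟨x, A'⟩
    · exact ⟨rfl, h⟩
    · have := hA' x (by simp)
      simp at hs
      omega
  | cons x A ih =>
    rcases A' with _ | ⟨y, A'⟩
    · have := hA x (by simp)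
      simp at hs
      omega
    · simp only [List.cons_append, List.cons.injEq] at h
      obtain ⟨rfl, h⟩ := h
      have := ih (fun i hi => hA i (by simp [hi])) (fun i hi => hA' i (by simp [hi]))
        (by simpa using hs) h
      exact ⟨by rw [this.1], this.2⟩

open Classical in
theorem sum_append_comps {M : Type*} [AddCommMonoid M] (m k : ℕ) (f : List ℕ → M) :
    ∑ A ∈ comps m, ∑ B ∈ comps k, f (A ++ B)
      = ∑ c ∈ comps (m + k) with IsPartialSum c m, f c := by
  rw [← Finset.sum_product']
  refine Finset.sum_bij (fun p _ => p.1 ++ p.2) ?_ ?_ ?_ ?_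
  · rintro ⟨A, B⟩ h
    simp only [Finset.mem_product] at h
    simp only [Finset.mem_filter]
    exact ⟨append_mem_comps h.1 h.2, A, B, rfl, (mem_comps.1 h.1).2⟩
  · rintro ⟨A, B⟩ h ⟨A', B'⟩ h' e
    simp only [Finset.mem_product, mem_comps] at h h'
    have := append_inj_of_sum h.1.1 h'.1.1 (h.1.2.trans h'.1.2.symm) e
    exact Prod.ext this.1 this.2
  · intro c hc
    simp only [Finset.mem_filter, mem_comps] at hc
    obtain ⟨⟨h1, h2⟩, A, B, rfl, rfl⟩ := hc
    refine ⟨(A, B), ?_, rfl⟩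
    simp only [Finset.mem_product, mem_comps]
    simp only [List.mem_append, List.sum_append] at h1 h2
    exact ⟨⟨fun i hi => h1 i (Or.inl hi), trivial⟩, fun i hi => h1 i (Or.inr hi), by omega⟩
  · intro p _
    rfl

theorem sum_comps_cons {M : Type*} [AddCommMonoid M] {n : ℕ} (hn : 0 < n) (f : List ℕ → M) :
    ∑ c ∈ comps n, f c
      = ∑ b ∈ Finset.Icc 1 n, ∑ C ∈ comps (n - b), f (b :: C) := by
  rw [Finset.sum_sigma']
  symm
  refine Finset.sum_bij (fun p _ => p.1 :: p.2) ?_ ?_ ?_ ?_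
  · rintro ⟨b, C⟩ h
    simp only [Finset.mem_sigma, Finset.mem_Icc, mem_comps] at h
    obtain ⟨⟨h1, h2⟩, h3, h4⟩ := h
    rw [mem_comps]
    refine ⟨fun i hi => ?_, by simp; omega⟩
    rcases List.mem_cons.1 hi with rfl | h
    exacts [h1, h3 i h]
  · rintro ⟨b, C⟩ _ ⟨b', C'⟩ _ e
    simp only [List.cons.injEq] at e
    obtain ⟨rfl, rfl⟩ := e
    rfl
  · intro c hc
    rcases c with _ | ⟨b, C⟩
    · exact absurd rfl (ne_nil_of_mem_comps hc hn)
    · rw [mem_comps] at hc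
      have hb := hc.1 b (by simp)
      have hs := hc.2
      simp only [List.sum_cons] at hs
      refine ⟨⟨b, C⟩, ?_, rfl⟩
      simp only [Finset.mem_sigma, Finset.mem_Icc, mem_comps]
      exact ⟨⟨hb, by omega⟩, fun i hi => hc.1 i (by simp [hi]), by omega⟩
  · intro p _
    rfl

theorem sum_comps_reverse {M : Type*} [AddCommMonoid M] (n : ℕ) (f : List ℕ → M) :
    ∑ c ∈ comps n, f c.reverse = ∑ c ∈ comps n, f c := by
  refine Finset.sum_nbij' List.reverse List.reverse ?_ ?_ ?_ ?_ ?_ <;> simp [mem_comps]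

theorem sum_comps_concat {M : Type*} [AddCommMonoid M] {n : ℕ} (hn : 0 < n) (f : List ℕ → M) :
    ∑ c ∈ comps n, f c
      = ∑ b ∈ Finset.Icc 1 n, ∑ C ∈ comps (n - b), f (C ++ [b]) := by
  rw [← sum_comps_reverse, sum_comps_cons hn]
  refine Finset.sum_congr rfl fun b _ => ?_
  rw [← sum_comps_reverse]
  simp

/-! ### Partial sums and `Θ` -/

theorem isPartialSum_sum (c : List ℕ) : IsPartialSum c c.sum :=
  ⟨c, [], by simp, rfl⟩

theorem isPartialSum_append_left {A : List ℕ} (B : List ℕ) {s : ℕ} (h : IsPartialSum A s) :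
    IsPartialSum (A ++ B) s := by
  obtain ⟨C, D, rfl, rfl⟩ := h
  exact ⟨C, D ++ B, by simp, rfl⟩

theorem isPartialSum_append_iff {A B : List ℕ} {s : ℕ} (hs : s ≤ A.sum) (hB : ∀ i ∈ B, 0 < i) :
    IsPartialSum (A ++ B) s ↔ IsPartialSum A s := by
  refine ⟨?_, isPartialSum_append_left B⟩
  rintro ⟨C, D, h, rfl⟩
  rcases List.append_eq_append_iff.1 h with ⟨E, rfl, rfl⟩ | ⟨E, rfl, rfl⟩
  · simp only [List.sum_append] at hs
    have : E = [] := by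
      rcases E with _ | ⟨x, E⟩
      · rfl
      · have := hB x (by simp)
        simp at hs
        omega
    subst this
    simpa using isPartialSum_sum A
  · exact ⟨C, E, rfl, rfl⟩

theorem le_of_isPartialSum_append_cons {A C : List ℕ} {b s : ℕ}
    (h : IsPartialSum (A ++ b :: C) s) (hs : A.sum < s) : A.sum + b ≤ s := by
  obtain ⟨D, E, h, rfl⟩ := h
  rcases List.append_eq_append_iff.1 h with ⟨F, rfl, h'⟩ | ⟨F, rfl, h'⟩
  · rcases F with _ | ⟨x, F⟩
    · simp at hs
    · simp only [List.cons_append, List.cons.injEq] at h'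
      simp
      omega
  · simp at hs

theorem isPartialSum_iff {n : ℕ} (K : Composition n) (s : ℕ) :
    IsPartialSum K.blocks s ↔ ∃ k ≤ K.length, K.sizeUpTo k = s := by
  constructor
  · rintro ⟨A, B, h, rfl⟩
    refine ⟨A.length, ?_, ?_⟩
    · simp [Composition.length, h]
    · simp [Composition.sizeUpTo, h]
  · rintro ⟨k, _, rfl⟩
    exact ⟨K.blocks.take k, K.blocks.drop k, by simp, rfl⟩

theorem Θ_le_iff {n : ℕ} (K : Composition n) {h : ℕ} (hn : h ≤ n) (t : ℕ) :
    Θ K h ≤ t ↔ ∃ s, h ≤ s ∧ s ≤ h + t ∧ IsPartialSum K.blocks s := by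
  have hne : {s | ∃ k ≤ K.length, K.sizeUpTo k = s ∧ h ≤ s}.Nonempty :=
    ⟨n, K.length, le_rfl, K.sizeUpTo_length, hn⟩
  constructor
  · intro ht
    obtain ⟨k, hk, hk', hh⟩ := Nat.sInf_mem hne
    refine ⟨_, hh, ?_, (isPartialSum_iff K _).2 ⟨k, hk, hk'⟩⟩
    unfold Θ σ at ht
    omega
  · rintro ⟨s, h1, h2, h3⟩
    obtain ⟨k, hk, hk'⟩ := (isPartialSum_iff K s).1 h3
    have : σ K h ≤ s := Nat.sInf_le ⟨k, hk, hk', h1⟩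
    unfold Θ
    omega

theorem three_le_Θ_iff {n : ℕ} (K : Composition n) {h : ℕ} (hn : h ≤ n) :
    3 ≤ Θ K h ↔ ¬ IsPartialSum K.blocks h ∧ ¬ IsPartialSum K.blocks (h + 1)
      ∧ ¬ IsPartialSum K.blocks (h + 2) := by
  rw [← not_lt, Nat.lt_succ_iff, Θ_le_iff K hn]
  constructor
  · intro H
    exact ⟨fun h' => H ⟨h, by omega, by omega, h'⟩, fun h' => H ⟨h + 1, by omega, by omega, h'⟩,
      fun h' => H ⟨h + 2, by omega, by omega, h'⟩⟩
  · rintro ⟨H1, H2, H3⟩ ⟨s, h1, h2, h3⟩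
    obtain rfl | rfl | rfl : s = h ∨ s = h + 1 ∨ s = h + 2 := by omega
    exacts [H1 h3, H2 h3, H3 h3]

theorem Θ_le_one_iff {n : ℕ} (K : Composition n) {h : ℕ} (hn : h ≤ n) :
    Θ K h ≤ 1 ↔ IsPartialSum K.blocks h ∨ IsPartialSum K.blocks (h + 1) := by
  rw [Θ_le_iff K hn]
  constructor
  · rintro ⟨s, h1, h2, h3⟩
    obtain rfl | rfl : s = h ∨ s = h + 1 := by omega
    exacts [Or.inl h3, Or.inr h3]
  · rintro (H | H)
    exacts [⟨h, by omega, by omega, H⟩, ⟨h + 1, by omega, by omega, H⟩]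

theorem Θ_eq_two_iff {n : ℕ} (K : Composition n) {h : ℕ} (hn : h ≤ n) :
    Θ K h = 2 ↔ ¬ IsPartialSum K.blocks h ∧ ¬ IsPartialSum K.blocks (h + 1)
      ∧ IsPartialSum K.blocks (h + 2) := by
  have h1 := three_le_Θ_iff K hn
  have h2 := Θ_le_one_iff K hn
  constructor
  · intro H
    have h1' := mt h1.2 (by omega)
    have h2' := mt h2.2 (by omega)
    tauto
  · intro H
    have h1' := mt h1.1 (by tauto)
    have h2' := mt h2.1 (by tauto)
    omega

theorem Θ_after_prefix {n : ℕ} (K : Composition n) {A C : List ℕ} {b : ℕ}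
    (hK : K.blocks = A ++ b :: C) : Θ K (A.sum + 1) = b - 1 := by
  have hb : 0 < b := K.blocks_pos (by simp [hK])
  have hn : A.sum + 1 ≤ n := by
    have := K.blocks_sum
    simp [hK] at this
    omega
  apply le_antisymm
  · rw [Θ_le_iff K hn]
    exact ⟨A.sum + b, by omega, by omega, A ++ [b], C, by simp [hK], by simp⟩
  · obtain ⟨s, h1, h2, h3⟩ := (Θ_le_iff K hn _).1 le_rfl
    rw [hK] at h3
    have := le_of_isPartialSum_append_cons h3 (by omega)
    omega

/-! ### Last parts -/

/-- The last entry of a list, `0` for the empty list. -/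
def lastPart (c : List ℕ) : ℕ := c.getLastD 0

theorem lastPart_concat (C : List ℕ) (b : ℕ) : lastPart (C ++ [b]) = b := by
  simp [lastPart]

theorem lastPart_append (A : List ℕ) {B : List ℕ} (hB : B ≠ []) :
    lastPart (A ++ B) = lastPart B := by
  obtain ⟨C, b, rfl⟩ := List.eq_nil_or_concat' B |>.resolve_left hB
  rw [← List.append_assoc, lastPart_concat, lastPart_concat]

theorem lastPart_cons (b : ℕ) {C : List ℕ} (hC : C ≠ []) : lastPart (b :: C) = lastPart C :=
  lastPart_append [b] hC

theorem lastPart_singleton (b : ℕ) : lastPart [b] = b := rfl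

theorem last_one {n : ℕ} (K : Composition n) : last K 1 = lastPart K.blocks := by
  unfold last
  rcases List.eq_nil_or_concat' K.blocks with h | ⟨C, b, h⟩
  · simp [h, lastPart]
  · simp [h, lastPart]

theorem last_two {n : ℕ} (K : Composition n) : last K 2 = lastPart K.blocks.dropLast := by
  unfold last
  rcases List.eq_nil_or_concat' K.blocks with h | ⟨C, b, h⟩
  · simp [h, lastPart]
  · rcases List.eq_nil_or_concat' C with h' | ⟨C', b', h'⟩
    · simp [h, h', lastPart]
    · subst h'
      rw [h, List.dropLast_concat, lastPart_concat]
      simp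

theorem lastPart_pos {n : ℕ} {c : List ℕ} (hc : c ∈ comps n) (hn : 0 < n) : 0 < lastPart c := by
  obtain ⟨C, b, rfl⟩ := List.eq_nil_or_concat' c |>.resolve_left (ne_nil_of_mem_comps hc hn)
  rw [lastPart_concat]
  exact (mem_comps.1 hc).1 b (by simp)

theorem lastPart_le_sum (c : List ℕ) : lastPart c ≤ c.sum := by
  rcases List.eq_nil_or_concat' c with rfl | ⟨C, b, rfl⟩
  · simp [lastPart]
  · rw [lastPart_concat]
    simp

theorem three_le_lastPart_iff {h : ℕ} {c : List ℕ} (hc : c ∈ comps (h + 2)) :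
    3 ≤ lastPart c ↔ ¬ IsPartialSum c h ∧ ¬ IsPartialSum c (h + 1) := by
  obtain ⟨C, b, rfl⟩ := List.eq_nil_or_concat' c |>.resolve_left (ne_nil_of_mem_comps hc (by omega))
  rw [lastPart_concat]
  rw [mem_comps] at hc
  have hb := hc.1 b (by simp)
  have hs := hc.2
  simp only [List.sum_append, List.sum_singleton] at hs
  constructor
  · intro hb3
    have key : ∀ s, s < h + 2 → h ≤ s → ¬ IsPartialSum (C ++ [b]) s := by
      intro s hs1 hs2 hP
      have := le_of_isPartialSum_append_cons hP (by omega)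
      omega
    exact ⟨key h (by omega) le_rfl, key (h + 1) (by omega) (by omega)⟩
  · rintro ⟨h1, h2⟩
    by_contra hb3
    obtain rfl | rfl : b = 1 ∨ b = 2 := by omega
    · exact h2 ⟨C, [1], rfl, by omega⟩
    · exact h1 ⟨C, [2], rfl, by omega⟩

/-! ### Weights -/

/-- `(i_1 - 1) (i_2 - 1) ⋯`. -/
def w' (I : List ℕ) : ℚ := (I.map fun j : ℕ => (j : ℚ) - 1).prod

theorem w_cons (b : ℕ) (C : List ℕ) : w (b :: C) = b * w' C := by
  simp [w, w', ← List.map_eq_flatMap, Function.comp_def]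

theorem w'_cons (b : ℕ) (C : List ℕ) : w' (b :: C) = (b - 1) * w' C := by simp [w']

theorem w'_append (A B : List ℕ) : w' (A ++ B) = w' A * w' B := by simp [w']

theorem w_append {A : List ℕ} (hA : A ≠ []) (B : List ℕ) : w (A ++ B) = w A * w' B := by
  rcases A with _ | ⟨x, A⟩
  · exact absurd rfl hA
  · rw [List.cons_append, w_cons, w_cons, w'_append, mul_assoc]

theorem w_concat {A : List ℕ} (hA : A ≠ []) (b : ℕ) : w (A ++ [b]) = w A * (b - 1) := by
  rw [w_append hA]
  simp [w']

theorem w_eq_zero_of_lastPart {A : List ℕ} (hs : A.sum ≠ 1) (h : lastPart A = 1) : w A = 0 := by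
  rcases List.eq_nil_or_concat' A with rfl | ⟨C, b, rfl⟩
  · simp [lastPart] at h
  · rw [lastPart_concat] at h
    subst h
    rw [w_concat]
    · simp
    · rintro rfl
      simp at hs

theorem w'_nonneg {I : List ℕ} (h : ∀ i ∈ I, 0 < i) : 0 ≤ w' I := by
  apply List.prod_nonneg
  intro x hx
  obtain ⟨i, hi, rfl⟩ := List.mem_map.1 hx
  have : (1 : ℚ) ≤ i := by exact_mod_cast h i hi
  linarith

theorem w_nonneg {I : List ℕ} (h : ∀ i ∈ I, 0 < i) : 0 ≤ w I := by
  rcases I with _ | ⟨b, C⟩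
  · simp [w]
  · rw [w_cons]
    exact mul_nonneg (Nat.cast_nonneg _) (w'_nonneg fun i hi => h i (by simp [hi]))

theorem elemSymmList_cons (b : ℕ) (C : List ℕ) :
    elemSymmList (b :: C) = elemSymm b * elemSymmList C := by
  simp [elemSymmList]

theorem elemSymmList_append (A B : List ℕ) :
    elemSymmList (A ++ B) = elemSymmList A * elemSymmList B := by
  simp [elemSymmList]

theorem elemSymmList_singleton (b : ℕ) : elemSymmList [b] = elemSymm b := by
  simp [elemSymmList]

/-- `w_I e_I`. -/
noncomputable def we (I : List ℕ) : MvPowerSeries ℕ ℚ := w I • elemSymmList I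

/-- `(i_1 - 1) (i_2 - 1) ⋯ e_I`. -/
noncomputable def we' (I : List ℕ) : MvPowerSeries ℕ ℚ := w' I • elemSymmList I

theorem we_append {A : List ℕ} (hA : A ≠ []) (B : List ℕ) : we (A ++ B) = we A * we' B := by
  rw [we, we, we', w_append hA, elemSymmList_append, smul_mul_smul_comm]

/-- The `e`-expansion `∑ w_I e_I` over the compositions `I` of `n` with last part at least `a`. -/
noncomputable def lollipopSeries (a n : ℕ) : MvPowerSeries ℕ ℚ :=
  ∑ c ∈ comps n with a ≤ lastPart c, we c

/-- The `e`-expansion `∑ w_I e_I` over the compositions `I` of `n`. -/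
noncomputable def pathSeries (n : ℕ) : MvPowerSeries ℕ ℚ := ∑ c ∈ comps n, we c

theorem lollipopSeries_one {n : ℕ} (hn : 0 < n) : lollipopSeries 1 n = pathSeries n := by
  unfold lollipopSeries pathSeries
  rw [Finset.filter_true_of_mem]
  intro c hc
  exact lastPart_pos hc hn

/-! ### Weighted sums over colorings -/

theorem finite_content {V : Type*} [Fintype V] (m : ℕ →₀ ℕ) :
    {κ : V → ℕ | ∑ v, Finsupp.single (κ v) 1 = m}.Finite := by
  refine Set.Finite.subset (Set.Finite.pi' fun _ : V => m.support.finite_toSet) ?_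
  rintro κ rfl v
  simp only [Finset.mem_coe, Finsupp.mem_support_iff, Finsupp.finsetSum_apply]
  have : Finsupp.single (κ v) 1 (κ v) ≤ ∑ u, Finsupp.single (κ u) 1 (κ v) :=
    Finset.single_le_sum (f := fun u => Finsupp.single (κ u) 1 (κ v)) (fun _ _ => Nat.zero_le _)
      (Finset.mem_univ v)
  simp only [Finsupp.single_eq_same] at this
  omega

/-- The colorings `κ : V → ℕ` with `∏_v x_{κ(v)} = x^m`. -/
noncomputable def colorings (V : Type*) [Fintype V] (m : ℕ →₀ ℕ) : Finset (V → ℕ) :=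
  (finite_content m).toFinset

theorem mem_colorings {V : Type*} [Fintype V] {m : ℕ →₀ ℕ} {κ : V → ℕ} :
    κ ∈ colorings V m ↔ ∑ v, Finsupp.single (κ v) 1 = m := by
  simp [colorings]

/-- The series `∑_κ f(κ) ∏_v x_{κ(v)}` over all maps `κ : V → ℕ`. -/
noncomputable def colorSum {V : Type*} [Fintype V] :
    ((V → ℕ) → ℚ) →ₗ[ℚ] MvPowerSeries ℕ ℚ where
  toFun f := fun m => ∑ κ ∈ colorings V m, f κ
  map_add' _ _ := funext fun _ => Finset.sum_add_distrib
  map_smul' _ _ := funext fun _ => (Finset.mul_sum _ _ _).symm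

theorem coeff_colorSum {V : Type*} [Fintype V] (f : (V → ℕ) → ℚ) (m : ℕ →₀ ℕ) :
    MvPowerSeries.coeff m (colorSum f) = ∑ κ ∈ colorings V m, f κ := rfl

theorem colorSum_comp_equiv {V W : Type*} [Fintype V] [Fintype W] (e : V ≃ W)
    (f : (V → ℕ) → ℚ) : colorSum (fun κ : W → ℕ => f (κ ∘ e)) = colorSum f := by
  ext m
  simp only [coeff_colorSum]
  refine Finset.sum_nbij' (fun κ => κ ∘ e) (fun κ => κ ∘ e.symm) ?_ ?_ ?_ ?_ ?_
  · intro κ hκ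
    rw [mem_colorings] at *
    rw [← hκ, ← Equiv.sum_comp e]
    rfl
  · intro κ hκ
    rw [mem_colorings] at *
    rw [← hκ, ← Equiv.sum_comp e.symm]
    rfl
  · intro κ _
    ext
    simp
  · intro κ _
    ext
    simp
  · intro κ _
    rfl

theorem colorSum_sum_mul {V W : Type*} [Fintype V] [Fintype W] (f : (V → ℕ) → ℚ)
    (g : (W → ℕ) → ℚ) :
    colorSum (fun κ : V ⊕ W → ℕ => f (κ ∘ Sum.inl) * g (κ ∘ Sum.inr))
      = colorSum f * colorSum g := by
  ext m
  rw [MvPowerSeries.coeff_mul]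
  simp only [coeff_colorSum, Finset.sum_mul_sum, ← Finset.sum_product']
  rw [Finset.sum_sigma']
  refine Finset.sum_bij'
    (fun κ _ => ⟨(∑ v, Finsupp.single (κ (Sum.inl v)) 1, ∑ v, Finsupp.single (κ (Sum.inr v)) 1),
      (κ ∘ Sum.inl, κ ∘ Sum.inr)⟩)
    (fun p _ => Sum.elim p.2.1 p.2.2) ?_ ?_ ?_ ?_ ?_
  · intro κ hκ
    rw [mem_colorings, Fintype.sum_sum_type] at hκ
    simp [mem_colorings, hκ]
  · rintro ⟨⟨p, q⟩, κ₁, κ₂⟩ h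
    simp only [Finset.mem_sigma, Finset.mem_product, mem_colorings] at h
    obtain ⟨h1, h2, h3⟩ := h
    simp [mem_colorings, Fintype.sum_sum_type, h2, h3, Finset.HasAntidiagonal.mem_antidiagonal.1 h1]
  · intro κ _
    ext v
    rcases v with v | v <;> rfl
  · rintro ⟨⟨p, q⟩, κ₁, κ₂⟩ h
    simp only [Finset.mem_sigma, Finset.mem_product, mem_colorings] at h
    obtain ⟨h1, rfl, rfl⟩ := h
    rfl
  · intro κ _
    rfl

theorem colorSum_mul {V W U : Type*} [Fintype V] [Fintype W] [Fintype U] (i : V → U) (j : W → U)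
    (hij : Function.Bijective (Sum.elim i j)) (f : (V → ℕ) → ℚ) (g : (W → ℕ) → ℚ) :
    colorSum (fun κ : U → ℕ => f (κ ∘ i) * g (κ ∘ j)) = colorSum f * colorSum g := by
  rw [← colorSum_sum_mul, ← colorSum_comp_equiv (Equiv.ofBijective _ hij)]
  rfl

/-! ### Graphs on `Fin n` given by a relation between smaller and larger vertices -/

/-- `κ` is a proper coloring of the graph on `Fin n` with the edges `i < j`, `R i j`. -/
def IsProper {n : ℕ} (R : ℕ → ℕ → Prop) (κ : Fin n → ℕ) : Prop :=
  ∀ i j : Fin n, i < j → R i j → κ i ≠ κ j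

open Classical in
/-- The indicator function of the proper colorings. -/
noncomputable def properInd {n : ℕ} (R : ℕ → ℕ → Prop) (κ : Fin n → ℕ) : ℚ :=
  if IsProper R κ then 1 else 0

/-- The chromatic symmetric function of the graph on `Fin n` with the edges `i < j`, `R i j`. -/
noncomputable def relSeries (n : ℕ) (R : ℕ → ℕ → Prop) : MvPowerSeries ℕ ℚ :=
  colorSum (properInd (n := n) R)

theorem properInd_eq_ite {n : ℕ} {R : ℕ → ℕ → Prop} {κ : Fin n → ℕ} {P : Prop} [Decidable P]
    (h : IsProper R κ ↔ P) : properInd R κ = if P then 1 else 0 := by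
  classical
  unfold properInd
  exact if_congr h rfl rfl

theorem properInd_congr {n : ℕ} {R R' : ℕ → ℕ → Prop}
    (h : ∀ i j, i < j → j < n → (R i j ↔ R' i j)) (κ : Fin n → ℕ) :
    properInd R κ = properInd R' κ := by
  have : IsProper R κ ↔ IsProper R' κ :=
    forall₃_congr fun i j hij => by rw [h i j hij j.2]
  classical
  exact properInd_eq_ite this

theorem relSeries_congr {n : ℕ} {R R' : ℕ → ℕ → Prop}
    (h : ∀ i j, i < j → j < n → (R i j ↔ R' i j)) : relSeries n R = relSeries n R' := by
  unfold relSeries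
  congr 1
  funext κ
  exact properInd_congr h κ

theorem chromaticSymm_eq_relSeries {V : Type*} [Fintype V] (G : SimpleGraph V) {n : ℕ}
    (e : V ≃ Fin n) (R : ℕ → ℕ → Prop)
    (h : ∀ x y, e x < e y → (G.Adj x y ↔ R (e x) (e y))) :
    chromaticSymm G = relSeries n R := by
  classical
  have hp : ∀ κ : Fin n → ℕ, IsProper R κ ↔ ∀ x y, G.Adj x y → (κ ∘ e) x ≠ (κ ∘ e) y := by
    intro κ
    constructor
    · intro H x y hxy
      rcases lt_trichotomy (e x) (e y) with hlt | heq | hlt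
      · exact H _ _ hlt ((h x y hlt).1 hxy)
      · exact absurd (e.injective heq) hxy.ne
      · exact (H _ _ hlt ((h y x hlt).1 hxy.symm)).symm
    · intro H i j hij hR
      have := H (e.symm i) (e.symm j) ((h _ _ (by simpa using hij)).2 (by simpa using hR))
      simpa using this
  have : relSeries n R = colorSum fun κ : V → ℕ => if ∀ x y, G.Adj x y → κ x ≠ κ y then 1 else 0 := by
    rw [← colorSum_comp_equiv e]
    unfold relSeries
    congr 1
    funext κ
    simp only [properInd, hp]
  rw [this]
  ext m
  rw [coeff_colorSum, Finset.sum_boole]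
  show (Nat.card _ : ℚ) = _
  congr 1
  rw [← Fintype.card_coe, ← Nat.card_eq_fintype_card]
  refine Nat.card_congr
    { toFun := fun κ => ⟨κ.1, Finset.mem_filter.2 ⟨mem_colorings.2 κ.2, fun x y h => κ.1.valid h⟩⟩
      invFun := fun κ => ⟨SimpleGraph.Coloring.mk κ.1 fun {x y} h => (Finset.mem_filter.1 κ.2).2 x y h,
        mem_colorings.1 (Finset.mem_filter.1 κ.2).1⟩
      left_inv := fun κ => rfl
      right_inv := fun κ => rfl }

theorem properInd_or_pair {n : ℕ} (R : ℕ → ℕ → Prop) (κ : Fin n → ℕ) (u v : Fin n) (huv : u < v) :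
    properInd (fun i j => R i j ∨ (i = u ∧ j = v)) κ
      = properInd R κ * if κ u = κ v then 0 else 1 := by
  have : IsProper (fun i j => R i j ∨ (i = u ∧ j = v)) κ ↔ IsProper R κ ∧ κ u ≠ κ v := by
    constructor
    · intro H
      exact ⟨fun i j hij hR => H i j hij (Or.inl hR), H u v huv (Or.inr ⟨rfl, rfl⟩)⟩
    · rintro ⟨H, hne⟩ i j hij (hR | ⟨h1, h2⟩)
      · exact H i j hij hR
      · rw [Fin.ext h1, Fin.ext h2]
        exact hne
  classical
  rw [properInd_eq_ite this]
  by_cases h1 : IsProper R κ <;> by_cases h2 : κ u = κ v <;> simp [properInd, h1, h2]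

theorem relSeries_mul_of_map {n m k : ℕ} (i : Fin m → Fin n) (j : Fin k → Fin n)
    (hi : StrictMono i) (hj : StrictMono j) (hij : Function.Bijective (Sum.elim i j))
    (R R₁ R₂ : ℕ → ℕ → Prop) (h₁ : ∀ x y, x < y → (R (i x) (i y) ↔ R₁ x y))
    (h₂ : ∀ x y, x < y → (R (j x) (j y) ↔ R₂ x y)) (h₃ : ∀ x y, i x < j y → ¬ R (i x) (j y))
    (h₄ : ∀ x y, j y < i x → ¬ R (j y) (i x)) :
    relSeries n R = relSeries m R₁ * relSeries k R₂ := by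
  unfold relSeries
  rw [← colorSum_mul i j hij]
  congr 1
  funext κ
  have : IsProper R κ ↔ IsProper R₁ (κ ∘ i) ∧ IsProper R₂ (κ ∘ j) := by
    constructor
    · intro H
      exact ⟨fun x y hxy hR => H _ _ (hi hxy) ((h₁ x y hxy).2 hR),
        fun x y hxy hR => H _ _ (hj hxy) ((h₂ x y hxy).2 hR)⟩
    · rintro ⟨H₁, H₂⟩ u v huv hR
      obtain ⟨x | x, rfl⟩ := hij.2 u <;> obtain ⟨y | y, rfl⟩ := hij.2 v <;>
        simp only [Sum.elim_inl, Sum.elim_inr] at *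
      · have hxy := hi.lt_iff_lt.1 huv
        exact H₁ x y hxy ((h₁ x y hxy).1 hR)
      · exact absurd hR (h₃ x y huv)
      · exact absurd hR (h₄ y x huv)
      · have hxy := hj.lt_iff_lt.1 huv
        exact H₂ x y hxy ((h₂ x y hxy).1 hR)
  classical
  rw [properInd_eq_ite this]
  by_cases h1 : IsProper R₁ (κ ∘ i) <;> by_cases h2 : IsProper R₂ (κ ∘ j) <;>
    simp [properInd, h1, h2]

theorem relSeries_split {n m k : ℕ} (hn : n = m + k) (R R₁ R₂ : ℕ → ℕ → Prop)
    (h₁ : ∀ i j, i < j → j < m → (R i j ↔ R₁ i j))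
    (h₂ : ∀ i j, i < j → j < k → (R (m + i) (m + j) ↔ R₂ i j))
    (h₃ : ∀ i j, i < m → m ≤ j → j < n → ¬ R i j) :
    relSeries n R = relSeries m R₁ * relSeries k R₂ := by
  subst hn
  refine relSeries_mul_of_map (Fin.castAdd k) (Fin.natAdd m) ?_ ?_ ?_ R R₁ R₂ ?_ ?_ ?_ ?_
  · exact Fin.strictMono_castAdd k
  · intro x y h
    simpa using h
  · exact (finSumFinEquiv (m := m) (n := k)).bijective
  · intro x y h
    exact h₁ x y h y.2
  · intro x y h
    exact h₂ x y h y.2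
  · intro x y _
    exact h₃ x (m + y) x.2 (by omega) (by omega)
  · intro x y h
    have : m + (y : ℕ) < x := h
    omega

theorem relSeries_isolated {n : ℕ} (p : Fin (n + 1)) (R R₂ : ℕ → ℕ → Prop)
    (h₂ : ∀ i j : Fin n, i < j → (R (p.succAbove i) (p.succAbove j) ↔ R₂ i j))
    (h₃ : ∀ i > (p : ℕ), ¬ R p i) (h₄ : ∀ i < (p : ℕ), ¬ R i p) :
    relSeries (n + 1) R = relSeries 1 (fun _ _ => True) * relSeries n R₂ := by
  refine relSeries_mul_of_map (fun _ => p) p.succAbove ?_ (Fin.strictMono_succAbove p) ?_ _ _ _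
    ?_ h₂ ?_ ?_
  · intro x y h
    omega
  · constructor
    · rintro (x | x) (y | y) h
      · rw [Subsingleton.elim x y]
      · exact absurd h.symm (Fin.succAbove_ne p y)
      · exact absurd h (Fin.succAbove_ne p x)
      · rw [Fin.succAbove_right_injective h]
    · intro x
      rcases Fin.eq_self_or_eq_succAbove p x with rfl | ⟨y, rfl⟩
      exacts [⟨Sum.inl 0, rfl⟩, ⟨Sum.inr y, rfl⟩]
  · intro x y h
    omega
  · intro x y h
    exact h₃ _ h
  · intro x y h
    exact h₄ _ h

/-! ### Complete graphs -/

theorem sum_single_apply (S : Finset ℕ) (j : ℕ) :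
    (∑ i ∈ S, Finsupp.single i 1 : ℕ →₀ ℕ) j = if j ∈ S then 1 else 0 := by
  simp [Finsupp.finsetSum_apply, Finsupp.single_apply]

theorem sum_single_injective {S T : Finset ℕ}
    (h : (∑ i ∈ S, Finsupp.single i 1 : ℕ →₀ ℕ) = ∑ i ∈ T, Finsupp.single i 1) : S = T := by
  ext j
  have := DFunLike.congr_fun h j
  rw [sum_single_apply, sum_single_apply] at this
  by_cases h1 : j ∈ S <;> by_cases h2 : j ∈ T <;> simp_all

theorem isProper_true_iff {n : ℕ} (κ : Fin n → ℕ) :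
    IsProper (fun _ _ => True) κ ↔ Function.Injective κ := by
  constructor
  · intro H i j hij
    rcases lt_trichotomy i j with h | h | h
    · exact absurd hij (H i j h trivial)
    · exact h
    · exact absurd hij.symm (H j i h trivial)
  · intro H i j hij _ h
    exact hij.ne (H h)

theorem relSeries_complete (a : ℕ) :
    relSeries a (fun _ _ => True) = (a ! : ℚ) • elemSymm a := by
  classical
  ext m
  have hL : MvPowerSeries.coeff m (relSeries a fun _ _ => True)
      = ((Finset.filter Function.Injective (colorings (Fin a) m)).card : ℚ) := by
    unfold relSeries
    rw [coeff_colorSum, ← Finset.sum_boole]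
    simp only [properInd, isProper_true_iff]
  have hR : MvPowerSeries.coeff m ((a ! : ℚ) • elemSymm a)
      = (a ! : ℚ) * (Nat.card {S : Finset ℕ // S.card = a ∧ ∑ i ∈ S, Finsupp.single i 1 = m} : ℚ) :=
    rfl
  have himg : ∀ κ : Fin a → ℕ, Function.Injective κ →
      ∑ i ∈ Finset.univ.image κ, Finsupp.single i 1 = (∑ v, Finsupp.single (κ v) 1 : ℕ →₀ ℕ) :=
    fun κ hκ => Finset.sum_image (hκ.injOn)
  rw [hL, hR]
  by_cases hS : ∃ S : Finset ℕ, S.card = a ∧ ∑ i ∈ S, Finsupp.single i 1 = m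
  · obtain ⟨S, hcard, rfl⟩ := hS
    have h1 : Nat.card {T : Finset ℕ //
        T.card = a ∧ ∑ i ∈ T, Finsupp.single i 1 = (∑ i ∈ S, Finsupp.single i 1 : ℕ →₀ ℕ)} = 1 := by
      rw [Nat.card_eq_one_iff_unique]
      refine ⟨⟨?_⟩, ⟨⟨S, hcard, rfl⟩⟩⟩
      rintro ⟨T, _, hT⟩ ⟨T', _, hT'⟩
      simp only [Subtype.mk.injEq]
      exact sum_single_injective (hT.trans hT'.symm)
    have h2 : (Finset.filter Function.Injective
        (colorings (Fin a) (∑ i ∈ S, Finsupp.single i 1))).card = a ! := by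
      have : Fintype.card (Fin a ↪ S) = a ! := by
        rw [Fintype.card_embedding_eq]
        simp [hcard, Nat.descFactorial_self]
      rw [← this, ← Finset.card_univ]
      symm
      refine Finset.card_bij (fun e _ v => (e v : ℕ)) ?_ ?_ ?_
      · intro e _
        have hinj : Function.Injective fun v => (e v : ℕ) :=
          Subtype.val_injective.comp e.injective
        rw [Finset.mem_filter, mem_colorings]
        refine ⟨?_, hinj⟩
        rw [← himg _ hinj]
        congr 1
        apply Finset.eq_of_subset_of_card_le
        · intro x hx
          obtain ⟨v, _, rfl⟩ := Finset.mem_image.1 hx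
          exact (e v).2
        · rw [Finset.card_image_of_injective _ hinj, hcard]
          simp
      · intro e _ e' _ h
        ext v
        exact congrFun h v
      · intro κ hκ
        rw [Finset.mem_filter, mem_colorings] at hκ
        obtain ⟨hκ, hinj⟩ := hκ
        rw [← himg _ hinj] at hκ
        have hT := sum_single_injective hκ
        refine ⟨⟨fun v => ⟨κ v, by rw [← hT]; simp⟩, fun u v h => hinj (congrArg Subtype.val h)⟩,
          Finset.mem_univ _, rfl⟩
    rw [h1, h2]
    simp
  · have h1 : IsEmpty {S : Finset ℕ // S.card = a ∧ ∑ i ∈ S, Finsupp.single i 1 = m} :=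
      ⟨fun S => hS ⟨S.1, S.2⟩⟩
    have h2 : Finset.filter Function.Injective (colorings (Fin a) m) = ∅ := by
      rw [Finset.filter_eq_empty_iff]
      intro κ hκ hinj
      rw [mem_colorings] at hκ
      exact hS ⟨Finset.univ.image κ, by simp [Finset.card_image_of_injective _ hinj],
        (himg κ hinj).trans hκ⟩
    rw [h2]
    simp

/-! ### Lollipops -/

/-- The edges `i < j` of the path `0 — 1 — 2 — ⋯`. -/
def pathRel (i j : ℕ) : Prop := j = i + 1

/-- The edges `i < j` of the lollipop with the path `0 — ⋯ — l` and the clique `l, l + 1, …`. -/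
def lollipopRel (l i j : ℕ) : Prop := l ≤ i ∨ j = i + 1

/-- The edges `i < j` of the disjoint union of the path `0 — ⋯ — l` and the clique
`l + 1, l + 2, …`. -/
def pathCliqueRel (l i j : ℕ) : Prop := l + 1 ≤ i ∨ (j = i + 1 ∧ j ≤ l)

theorem isProper_pathClique_swap {n l : ℕ} {κ : Fin n → ℕ} {c d : Fin n} (hc : l < c) (hd : l < d)
    (H : IsProper (pathCliqueRel l) κ) : IsProper (pathCliqueRel l) (κ ∘ Equiv.swap c d) := by
  have hlt : ∀ i : Fin n, l < i → l < (Equiv.swap c d i : Fin n) := by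
    intro i hi
    rw [Equiv.swap_apply_def]
    split_ifs <;> assumption
  have hclique : ∀ i j : Fin n, i ≠ j → l < i → l < j → κ i ≠ κ j := by
    intro i j hij hi hj
    rcases lt_or_gt_of_ne hij with h | h
    · exact H i j h (Or.inl hi)
    · exact (H j i h (Or.inl hj)).symm
  have hfix : ∀ i : Fin n, (i : ℕ) ≤ l → Equiv.swap c d i = i := by
    intro i hi
    apply Equiv.swap_apply_of_ne_of_ne
    · rintro rfl
      omega
    · rintro rfl
      omega
  intro i j hij hR
  simp only [Function.comp]
  rcases hR with hR | ⟨hR, hR'⟩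
  · exact hclique _ _ (fun h => hij.ne ((Equiv.swap c d).injective h)) (hlt i hR)
      (hlt j (by omega))
  · rw [hfix i (by omega), hfix j hR']
    exact H i j hij (Or.inr ⟨hR, hR'⟩)

theorem properInd_pathClique_swap {n l : ℕ} (κ : Fin n → ℕ) {c d : Fin n} (hc : l < c)
    (hd : l < d) :
    properInd (pathCliqueRel l) (κ ∘ Equiv.swap c d) = properInd (pathCliqueRel l) κ := by
  classical
  refine properInd_eq_ite ⟨fun H => ?_, isProper_pathClique_swap hc hd⟩
  have := isProper_pathClique_swap hc hd H
  rwa [Function.comp_assoc, ← Equiv.coe_trans, Equiv.swap_swap, Equiv.coe_refl,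
    Function.comp_id] at this

theorem sum_ite_eq_of_injective {a : ℕ} (f : Fin a → ℕ) (hf : Function.Injective f) (x : ℕ)
    [Decidable (∀ t, x ≠ f t)] :
    (if ∀ t, x ≠ f t then (1 : ℚ) else 0) = (∑ t, if x = f t then (0 : ℚ) else 1) - (a - 1) := by
  by_cases h : ∀ t, x ≠ f t
  · simp [h]
  · rw [if_neg h]
    push Not at h
    obtain ⟨t, rfl⟩ := h
    have : ∀ s, (if f t = f s then (0 : ℚ) else 1) = 1 - if t = s then 1 else 0 := by
      intro s
      by_cases hs : t = s
      · simp [hs]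
      · simp [hs, hf.ne hs]
    simp [this]

theorem lollipop_recursion {a : ℕ} (ha : 1 ≤ a) (l : ℕ) :
    relSeries (a + (l + 1)) (lollipopRel l)
      = (a : ℚ) • relSeries (a + (l + 1)) (lollipopRel (l + 1))
        - ((a : ℚ) - 1) • (relSeries (l + 1) pathRel * relSeries a fun _ _ => True) := by
  classical
  let u : Fin (a + (l + 1)) := ⟨l, by omega⟩
  let c : Fin a → Fin (a + (l + 1)) := fun t => ⟨l + 1 + t, by omega⟩
  have huc : ∀ t, u < c t := fun t => by
    show l < l + 1 + t
    omega
  let f : Fin a → (Fin (a + (l + 1)) → ℕ) → ℚ := fun t κ =>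
    properInd (pathCliqueRel l) κ * if κ u = κ (c t) then 0 else 1
  have h1 : ∀ κ : Fin (a + (l + 1)) → ℕ, properInd (lollipopRel l) κ
      = ∑ t, f t κ - ((a : ℚ) - 1) * properInd (pathCliqueRel l) κ := by
    intro κ
    have hP : IsProper (lollipopRel l) κ
        ↔ IsProper (pathCliqueRel l) κ ∧ ∀ t, κ u ≠ κ (c t) := by
      constructor
      · intro H
        refine ⟨fun i j hij hR => H i j hij ?_, fun t => H u (c t) (huc t) (Or.inl le_rfl)⟩
        rcases hR with hR | hR
        · exact Or.inl (by omega)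
        · exact Or.inr hR.1
      · rintro ⟨H, H'⟩ i j hij hR
        by_cases hi : (i : ℕ) = l
        · have hj : j = c ⟨j - (l + 1), by omega⟩ := by
            apply Fin.ext
            show (j : ℕ) = l + 1 + (j - (l + 1))
            omega
          rw [show i = u from Fin.ext hi, hj]
          exact H' _
        · refine H i j hij ?_
          unfold lollipopRel at hR
          unfold pathCliqueRel
          omega
    rw [properInd_eq_ite hP]
    by_cases H : IsProper (pathCliqueRel l) κ
    · have hinj : Function.Injective fun t => κ (c t) := by
        intro s t hst
        by_contra hne
        rcases lt_or_gt_of_ne hne with h | h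
        · exact H (c s) (c t) (by show l + 1 + (s : ℕ) < l + 1 + t; omega)
            (Or.inl (by show l + 1 ≤ l + 1 + (s : ℕ); omega)) hst
        · exact H (c t) (c s) (by show l + 1 + (t : ℕ) < l + 1 + s; omega)
            (Or.inl (by show l + 1 ≤ l + 1 + (t : ℕ); omega)) hst.symm
      have := sum_ite_eq_of_injective _ hinj (κ u)
      simp only [f, properInd, H, if_true, true_and, one_mul, mul_one]
      exact this
    · simp [f, properInd, H]
  have h2 : ∀ t, colorSum (f t) = relSeries (a + (l + 1)) (lollipopRel (l + 1)) := by
    intro t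
    have h0 : colorSum (f ⟨0, ha⟩) = relSeries (a + (l + 1)) (lollipopRel (l + 1)) := by
      unfold relSeries
      congr 1
      funext κ
      show properInd _ κ * _ = _
      rw [← properInd_or_pair _ κ u (c ⟨0, ha⟩) (huc _)]
      apply properInd_congr
      intro i j hij hj
      show (l + 1 ≤ i ∨ (j = i + 1 ∧ j ≤ l)) ∨ (i = l ∧ j = l + 1 + 0) ↔ l + 1 ≤ i ∨ j = i + 1
      omega
    rw [← h0, ← colorSum_comp_equiv (Equiv.swap (c ⟨0, ha⟩) (c t)) (f ⟨0, ha⟩)]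
    congr 1
    funext κ
    have hl : ∀ s, l < (c s : ℕ) := fun s => huc s
    have hu : Equiv.swap (c ⟨0, ha⟩) (c t) u = u :=
      Equiv.swap_apply_of_ne_of_ne (huc _).ne (huc _).ne
    simp only [f]
    rw [properInd_pathClique_swap κ (hl _) (hl _)]
    simp only [Function.comp, hu, Equiv.swap_apply_left]
  have h3 : relSeries (a + (l + 1)) (pathCliqueRel l)
      = relSeries (l + 1) pathRel * relSeries a fun _ _ => True := by
    apply relSeries_split (by omega) <;> intros <;> simp only [pathCliqueRel, pathRel, iff_true] at * <;>
      omega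
  have h4 : properInd (n := a + (l + 1)) (lollipopRel l)
      = ∑ t, f t - ((a : ℚ) - 1) • properInd (pathCliqueRel l) := by
    funext κ
    rw [h1]
    simp
  rw [relSeries, h4, map_sub, map_sum, map_smul, Finset.sum_congr rfl fun t _ => h2 t]
  change _ - _ • relSeries (a + (l + 1)) (pathCliqueRel l) = _
  rw [h3]
  simp [Nat.cast_smul_eq_nsmul]

theorem lollipopSeries_succ (a : ℕ) {l : ℕ} (hl : 0 < l) (ha : 1 ≤ a) :
    lollipopSeries a (a + l)
      = lollipopSeries (a + 1) (a + l) + ((a : ℚ) - 1) • (elemSymm a * pathSeries l) := by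
  unfold lollipopSeries pathSeries
  rw [Finset.sum_filter, Finset.sum_filter, ← sub_eq_iff_eq_add', ← Finset.sum_sub_distrib,
    sum_comps_concat (by omega), Finset.sum_eq_single_of_mem a (by simp; omega)]
  · rw [Nat.add_sub_cancel_left, Finset.mul_sum, Finset.smul_sum]
    refine Finset.sum_congr rfl fun C hC => ?_
    rw [lastPart_concat, if_pos le_rfl, if_neg (by omega), sub_zero, we, we,
      w_concat (ne_nil_of_mem_comps hC hl), elemSymmList_append, elemSymmList_singleton,
      mul_comm (w C), mul_smul, mul_comm (elemSymmList C), mul_smul_comm]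
  · intro b _ hb
    refine Finset.sum_eq_zero fun C _ => ?_
    rw [lastPart_concat]
    split_ifs <;> first | omega | simp

theorem lollipopSeries_self {a : ℕ} (ha : 0 < a) :
    lollipopSeries a a = (a : ℚ) • elemSymm a := by
  unfold lollipopSeries
  rw [Finset.sum_filter, sum_comps_concat ha, Finset.sum_eq_single_of_mem a (by simp; omega)]
  · rw [Nat.sub_self, comps_zero]
    simp [lastPart, we, w_cons, w', elemSymmList]
  · intro b hb hne
    refine Finset.sum_eq_zero fun C _ => ?_
    simp only [Finset.mem_Icc] at hb
    rw [lastPart_concat, if_neg (by omega)]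

theorem relSeries_pathRel_eq_lollipop (l : ℕ) :
    relSeries (l + 1) pathRel = relSeries (1 + l) (lollipopRel l) := by
  rw [add_comm 1 l]
  apply relSeries_congr
  intro i j
  simp only [lollipopRel, pathRel]
  omega

/-- The `e`-expansion of the chromatic symmetric function of a lollipop. -/
theorem relSeries_lollipop (l : ℕ) : ∀ {a : ℕ}, 1 ≤ a →
    relSeries (a + l) (lollipopRel l) = ((a - 1)! : ℚ) • lollipopSeries a (a + l) := by
  have hfact : ∀ {a : ℕ}, 1 ≤ a → (a ! : ℚ) = a * ((a - 1)! : ℚ) := by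
    intro a ha
    rw [← Nat.mul_factorial_pred (by omega : a ≠ 0)]
    push_cast
    rfl
  induction l with
  | zero =>
    intro a ha
    rw [Nat.add_zero, lollipopSeries_self ha, smul_smul, mul_comm, ← hfact ha,
      ← relSeries_complete]
    apply relSeries_congr
    intro i j _ _
    simp [lollipopRel]
  | succ l ih =>
    intro a ha
    have h1 := lollipop_recursion ha l
    have h2 := ih (a := a + 1) (by omega)
    rw [show a + 1 + l = a + (l + 1) by omega, Nat.add_sub_cancel] at h2
    have h3 : relSeries (l + 1) pathRel = pathSeries (l + 1) := by
      rw [relSeries_pathRel_eq_lollipop, ih le_rfl, add_comm 1 l, lollipopSeries_one (by omega)]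
      simp
    rw [h2, h3, relSeries_complete, hfact ha] at h1
    rw [lollipopSeries_succ a (by omega) ha]
    have ha' : (a : ℚ) ≠ 0 := by
      have : a ≠ 0 := by omega
      exact_mod_cast this
    have h4 := congrArg (fun x => (a : ℚ)⁻¹ • x) (sub_eq_iff_eq_add.1 h1.symm)
    simp only [smul_add, smul_smul, mul_smul_comm, inv_mul_cancel₀ ha', one_smul] at h4
    rw [h4, smul_add, smul_smul, mul_comm (pathSeries (l + 1))]
    congr 2
    · field_simp
    · field_simp

theorem relSeries_path {m : ℕ} (hm : 0 < m) : relSeries m pathRel = pathSeries m := by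
  obtain ⟨l, rfl⟩ : ∃ l, m = l + 1 := ⟨m - 1, by omega⟩
  rw [relSeries_pathRel_eq_lollipop, relSeries_lollipop l le_rfl, add_comm 1 l,
    lollipopSeries_one (by omega)]
  simp

/-! ### Twinned lollipops -/

/-- The edges `i < j` of the twinned lollipop with path part `0 — ⋯ — g — {g + 1, g + 2} — g + 3 — ⋯`
and clique `l, l + 1, …`. -/
def twinRel (g l i j : ℕ) : Prop :=
  lollipopRel l i j ∨ (i = g ∧ j = g + 2) ∨ (i = g + 1 ∧ j = g + 3)

theorem val_succAbove {n : ℕ} (p : Fin (n + 1)) (i : Fin n) :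
    (p.succAbove i : ℕ) = if (i : ℕ) < p then (i : ℕ) else i + 1 := by
  unfold Fin.succAbove
  simp only [Fin.lt_def, Fin.val_castSucc]
  split_ifs <;> simp

theorem chromaticSymm_twinnedLollipop (a l g : ℕ) (hh : g + 1 < l) :
    chromaticSymm (twinnedLollipop a l (g + 1) hh)
      = relSeries (a + l + 1) (twinRel g (l + 1)) := by
  obtain ⟨p, hp⟩ : ∃ p : Fin (a + l + 1), (p : ℕ) = g + 1 := ⟨⟨g + 1, by omega⟩, rfl⟩
  apply chromaticSymm_eq_relSeries _ (finSuccEquiv' p).symm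
  rintro (_ | x) (_ | y) hxy
  · exact absurd hxy (lt_irrefl _)
  · rw [finSuccEquiv'_symm_some, finSuccEquiv'_symm_none] at *
    show (y = _ ∨ _ ≠ y ∧ _) ↔ twinRel g (l + 1) p (p.succAbove y)
    have h1 : (p : ℕ) < (p.succAbove y : ℕ) := hxy
    have h2 := val_succAbove p y
    simp only [twinRel, lollipopRel, Fin.ext_iff, ne_eq] at *
    split_ifs at h2 <;> omega
  · rw [finSuccEquiv'_symm_some, finSuccEquiv'_symm_none] at *
    show (x = _ ∨ _ ≠ x ∧ _) ↔ twinRel g (l + 1) (p.succAbove x) p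
    have h1 : (p.succAbove x : ℕ) < p := hxy
    have h2 := val_succAbove p x
    simp only [twinRel, lollipopRel, Fin.ext_iff, ne_eq] at *
    split_ifs at h2 <;> omega
  · rw [finSuccEquiv'_symm_some, finSuccEquiv'_symm_some] at *
    show (x ≠ y ∧ _) ↔ twinRel g (l + 1) (p.succAbove x) (p.succAbove y)
    have h1 : (p.succAbove x : ℕ) < p.succAbove y := hxy
    have h2 := val_succAbove p x
    have h3 := val_succAbove p y
    simp only [twinRel, lollipopRel, Fin.ext_iff, ne_eq] at *
    split_ifs at h2 h3 <;> omega

/-- `1` if `x ≠ y`, otherwise `0`. -/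
def neInd (x y : ℕ) : ℚ := if x = y then 0 else 1

theorem neInd_comm (x y : ℕ) : neInd x y = neInd y x := by
  simp only [neInd, eq_comm]

/-- The inclusion-exclusion identity for a diamond with the tips `x`, `y`, symmetrised in the two
adjacent vertices `p`, `q`. -/
theorem neInd_diamond (x p q y : ℕ) :
    neInd x p * neInd x q * neInd p q * neInd p y * neInd q y
      = 2 * (neInd x p * neInd p q * neInd q y) + 2 * (neInd x q * neInd p q * neInd p y)
        + neInd x p * neInd p y + neInd x q * neInd q y
        - neInd x p * neInd q y - neInd x q * neInd p y
        - neInd x p * neInd p q - neInd x q * neInd p q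
        - neInd p q * neInd q y - neInd p q * neInd p y + neInd p q := by
  have hor : ∀ u, p ≠ q → neInd u p = 1 ∨ neInd u q = 1 := by
    intro u h
    by_contra! h'
    have h1 : u = p := by_contra fun hne => h'.1 (if_neg hne)
    have h2 : u = q := by_contra fun hne => h'.2 (if_neg hne)
    exact h (h1.symm.trans h2)
  rw [neInd_comm p y, neInd_comm q y]
  by_cases h : p = q
  · subst h
    rw [show neInd p p = 0 from if_pos rfl]
    ring
  · rw [show neInd p q = 1 from if_neg h]
    rcases hor x h with h1 | h1 <;> rcases hor y h with h2 | h2 <;> rw [h1, h2] <;> ring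

/-- The edges `i < j` of the twinned lollipop that meet neither of `g + 1`, `g + 2`. -/
def twinBaseRel (g l i j : ℕ) : Prop :=
  (j = i + 1 ∧ (j ≤ g ∨ g + 3 ≤ i)) ∨ l ≤ i

theorem properInd_twinBase_swap {n g l : ℕ} (hl : g + 3 ≤ l) (κ : Fin n → ℕ) (p q : Fin n)
    (hp : (p : ℕ) = g + 1) (hq : (q : ℕ) = g + 2) :
    properInd (twinBaseRel g l) (κ ∘ Equiv.swap p q) = properInd (twinBaseRel g l) κ := by
  classical
  refine properInd_eq_ite (forall₄_congr fun i j hij hR => ?_)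
  have hij' : (i : ℕ) < j := hij
  have hfix : ∀ v : Fin n, (v : ℕ) ≤ g ∨ g + 3 ≤ (v : ℕ) → Equiv.swap p q v = v := by
    intro v hv
    apply Equiv.swap_apply_of_ne_of_ne <;>
    · rintro rfl
      omega
  unfold twinBaseRel at hR
  simp only [Function.comp, hfix i (by omega), hfix j (by omega)]

theorem colorSum_diamond {V : Type*} [Fintype V] [DecidableEq V] (B : (V → ℕ) → ℚ) {x p q y : V}
    (hxp : x ≠ p) (hxq : x ≠ q) (hpy : p ≠ y) (hqy : q ≠ y)
    (hB : ∀ κ, B (κ ∘ Equiv.swap p q) = B κ) :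
    colorSum (fun κ => B κ * (neInd (κ x) (κ p) * neInd (κ x) (κ q) * neInd (κ p) (κ q)
      * neInd (κ p) (κ y) * neInd (κ q) (κ y)))
      = (4 : ℚ) • colorSum (fun κ => B κ
          * (neInd (κ x) (κ p) * neInd (κ p) (κ q) * neInd (κ q) (κ y)))
        + (2 : ℚ) • colorSum (fun κ => B κ * (neInd (κ x) (κ q) * neInd (κ q) (κ y)))
        - (2 : ℚ) • colorSum (fun κ => B κ * (neInd (κ x) (κ p) * neInd (κ q) (κ y)))
        - (2 : ℚ) • colorSum (fun κ => B κ * (neInd (κ x) (κ p) * neInd (κ p) (κ q)))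
        - (2 : ℚ) • colorSum (fun κ => B κ * (neInd (κ p) (κ q) * neInd (κ q) (κ y)))
        + colorSum (fun κ => B κ * neInd (κ p) (κ q)) := by
  have swap : ∀ E : (V → ℕ) → ℚ, colorSum (fun κ => B κ * E (κ ∘ Equiv.swap p q))
      = colorSum (fun κ => B κ * E κ) := by
    intro E
    rw [← colorSum_comp_equiv (Equiv.swap p q) fun κ => B κ * E κ]
    congr 1
    funext κ
    rw [hB]
  have sx : Equiv.swap p q x = x := Equiv.swap_apply_of_ne_of_ne hxp hxq
  have sy : Equiv.swap p q y = y := Equiv.swap_apply_of_ne_of_ne hpy.symm hqy.symm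
  have s1 := swap fun κ => neInd (κ x) (κ p) * neInd (κ p) (κ q) * neInd (κ q) (κ y)
  have s2 := swap fun κ => neInd (κ x) (κ q) * neInd (κ q) (κ y)
  have s3 := swap fun κ => neInd (κ x) (κ p) * neInd (κ q) (κ y)
  have s4 := swap fun κ => neInd (κ x) (κ p) * neInd (κ p) (κ q)
  have s5 := swap fun κ => neInd (κ p) (κ q) * neInd (κ q) (κ y)
  simp only [Function.comp, sx, sy, Equiv.swap_apply_left, Equiv.swap_apply_right]
    at s1 s2 s3 s4 s5
  have key : (fun κ : V → ℕ => B κ * (neInd (κ x) (κ p) * neInd (κ x) (κ q)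
      * neInd (κ p) (κ q) * neInd (κ p) (κ y) * neInd (κ q) (κ y)))
      = (2 : ℚ) • (fun κ => B κ * (neInd (κ x) (κ p) * neInd (κ p) (κ q) * neInd (κ q) (κ y)))
        + (2 : ℚ) • (fun κ => B κ * (neInd (κ x) (κ q) * neInd (κ q) (κ p) * neInd (κ p) (κ y)))
        + (fun κ => B κ * (neInd (κ x) (κ p) * neInd (κ p) (κ y)))
        + (fun κ => B κ * (neInd (κ x) (κ q) * neInd (κ q) (κ y)))
        - (fun κ => B κ * (neInd (κ x) (κ p) * neInd (κ q) (κ y)))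
        - (fun κ => B κ * (neInd (κ x) (κ q) * neInd (κ p) (κ y)))
        - (fun κ => B κ * (neInd (κ x) (κ p) * neInd (κ p) (κ q)))
        - (fun κ => B κ * (neInd (κ x) (κ q) * neInd (κ q) (κ p)))
        - (fun κ => B κ * (neInd (κ p) (κ q) * neInd (κ q) (κ y)))
        - (fun κ => B κ * (neInd (κ q) (κ p) * neInd (κ p) (κ y)))
        + (fun κ => B κ * neInd (κ p) (κ q)) := by
    funext κ
    simp only [Pi.add_apply, Pi.sub_apply, Pi.smul_apply, smul_eq_mul]
    rw [neInd_diamond, neInd_comm (κ q) (κ p)]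
    ring
  rw [key]
  simp only [map_add, map_sub, map_smul, s1, s2, s3, s4, s5]
  module

theorem relSeries_twin_isolated (a k g : ℕ) :
    relSeries (a + (k + g + 2) + 1) (fun i j => twinBaseRel g (k + g + 3) i j
      ∨ (i = g ∧ j = g + 2) ∨ (i = g + 2 ∧ j = g + 3))
      = relSeries 1 (fun _ _ => True)
        * relSeries (a + (k + g + 2)) (lollipopRel (k + g + 2)) := by
  obtain ⟨p, hp⟩ : ∃ p : Fin (a + (k + g + 2) + 1), (p : ℕ) = g + 1 :=
    ⟨⟨g + 1, by omega⟩, rfl⟩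
  apply relSeries_isolated p
  · intro i j hij
    have hij' : (i : ℕ) < j := hij
    have h1 := val_succAbove p i
    have h2 := val_succAbove p j
    unfold lollipopRel twinBaseRel
    split_ifs at h1 h2 <;> omega
  · intro i h
    unfold twinBaseRel
    omega
  · intro i h
    unfold twinBaseRel
    omega

set_option maxHeartbeats 1000000 in
theorem relSeries_twinRel {a : ℕ} (ha : 1 ≤ a) (k g : ℕ) :
    relSeries (a + (k + g + 3)) (twinRel g (k + g + 3))
      = (4 : ℚ) • relSeries (a + (k + g + 3)) (lollipopRel (k + g + 3))
        + (2 : ℚ) • (relSeries 1 (fun _ _ => True)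
          * relSeries (a + (k + g + 2)) (lollipopRel (k + g + 2)))
        - (2 : ℚ) • (relSeries (g + 2) pathRel * relSeries (a + (k + 1)) (lollipopRel (k + 1)))
        - (2 : ℚ) • (relSeries (g + 3) pathRel * relSeries (a + k) (lollipopRel k))
        - (2 : ℚ) • (relSeries (g + 1) pathRel * relSeries (a + (k + 2)) (lollipopRel (k + 2)))
        + relSeries (g + 1) pathRel
          * (relSeries 2 pathRel * relSeries (a + k) (lollipopRel k)) := by
  obtain ⟨n, hn⟩ : ∃ n, n = a + (k + g + 3) := ⟨_, rfl⟩
  obtain ⟨x, hx⟩ : ∃ x : Fin n, (x : ℕ) = g := ⟨⟨g, by omega⟩, rfl⟩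
  obtain ⟨p, hp⟩ : ∃ p : Fin n, (p : ℕ) = g + 1 := ⟨⟨g + 1, by omega⟩, rfl⟩
  obtain ⟨q, hq⟩ : ∃ q : Fin n, (q : ℕ) = g + 2 := ⟨⟨g + 2, by omega⟩, rfl⟩
  obtain ⟨y, hy⟩ : ∃ y : Fin n, (y : ℕ) = g + 3 := ⟨⟨g + 3, by omega⟩, rfl⟩
  let B : (Fin n → ℕ) → ℚ := properInd (twinBaseRel g (k + g + 3))
  have step : ∀ (R : ℕ → ℕ → Prop) (u v : Fin n), u < v → ∀ κ : Fin n → ℕ,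
      properInd (fun i j => R i j ∨ (i = u ∧ j = v)) κ = properInd R κ * neInd (κ u) (κ v) :=
    fun R u v huv κ => properInd_or_pair R κ u v huv
  have hxp : x < p := by show (x : ℕ) < p; omega
  have hxq : x < q := by show (x : ℕ) < q; omega
  have hpq : p < q := by show (p : ℕ) < q; omega
  have hpy : p < y := by show (p : ℕ) < y; omega
  have hqy : q < y := by show (q : ℕ) < y; omega
  have one : ∀ (R : ℕ → ℕ → Prop) (u v : Fin n), u < v →
      (∀ i j, i < j → j < n → (R i j ↔ twinBaseRel g (k + g + 3) i j ∨ (i = u ∧ j = v))) →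
      colorSum (fun κ => B κ * neInd (κ u) (κ v)) = relSeries n R := by
    intro R u v huv h
    unfold relSeries
    congr 1
    funext κ
    rw [properInd_congr h, step _ _ _ huv]
  have two : ∀ (R : ℕ → ℕ → Prop) (u v u' v' : Fin n), u < v → u' < v' →
      (∀ i j, i < j → j < n → (R i j ↔ (twinBaseRel g (k + g + 3) i j ∨ (i = u ∧ j = v))
        ∨ (i = u' ∧ j = v'))) →
      colorSum (fun κ => B κ * (neInd (κ u) (κ v) * neInd (κ u') (κ v'))) = relSeries n R := by
    intro R u v u' v' huv huv' h
    unfold relSeries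
    congr 1
    funext κ
    rw [properInd_congr h, step _ _ _ huv', step _ _ _ huv, mul_assoc]
  have three : colorSum (fun κ => B κ * (neInd (κ x) (κ p) * neInd (κ p) (κ q)
      * neInd (κ q) (κ y))) = relSeries n (lollipopRel (k + g + 3)) := by
    unfold relSeries
    congr 1
    funext κ
    rw [properInd_congr (R' := fun i j => ((twinBaseRel g (k + g + 3) i j ∨ (i = x ∧ j = p))
      ∨ (i = p ∧ j = q)) ∨ (i = q ∧ j = y)), step _ _ _ hqy, step _ _ _ hpq, step _ _ _ hxp]
    · ring
    · intro i j hij hj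
      unfold twinBaseRel lollipopRel
      omega
  have five : colorSum (fun κ => B κ * (neInd (κ x) (κ p) * neInd (κ x) (κ q) * neInd (κ p) (κ q)
      * neInd (κ p) (κ y) * neInd (κ q) (κ y))) = relSeries n (twinRel g (k + g + 3)) := by
    unfold relSeries
    congr 1
    funext κ
    rw [properInd_congr (R' := fun i j => ((((twinBaseRel g (k + g + 3) i j ∨ (i = x ∧ j = p))
      ∨ (i = x ∧ j = q)) ∨ (i = p ∧ j = q)) ∨ (i = p ∧ j = y)) ∨ (i = q ∧ j = y)),
      step _ _ _ hqy, step _ _ _ hpy, step _ _ _ hpq, step _ _ _ hxq, step _ _ _ hxp]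
    · ring
    · intro i j hij hj
      unfold twinBaseRel twinRel lollipopRel
      omega
  have t2 := two (fun i j => twinBaseRel g (k + g + 3) i j ∨ (i = g ∧ j = g + 2)
    ∨ (i = g + 2 ∧ j = g + 3)) x q q y hxq hqy (by intros; unfold twinBaseRel; omega)
  have t3 := two (fun i j => lollipopRel (k + g + 3) i j ∧ ¬ (i = g + 1 ∧ j = g + 2)) x p q y
    hxp hqy (by intros; unfold lollipopRel twinBaseRel; omega)
  have t4 := two (fun i j => lollipopRel (k + g + 3) i j ∧ ¬ (i = g + 2 ∧ j = g + 3)) x p p q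
    hxp hpq (by intros; unfold lollipopRel twinBaseRel; omega)
  have t5 := two (fun i j => lollipopRel (k + g + 3) i j ∧ ¬ (i = g ∧ j = g + 1)) p q q y
    hpq hqy (by intros; unfold lollipopRel twinBaseRel; omega)
  have t6 := one (fun i j => lollipopRel (k + g + 3) i j ∧ ¬ (i = g ∧ j = g + 1)
    ∧ ¬ (i = g + 2 ∧ j = g + 3)) p q
    hpq (by intros; unfold lollipopRel twinBaseRel; omega)
  rw [relSeries_split (n := n) (m := g + 2) (k := a + (k + 1)) (by omega) _ pathRel
    (lollipopRel (k + 1)) (by intros; unfold lollipopRel pathRel; omega)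
    (by intros; unfold lollipopRel; omega) (by intros; unfold lollipopRel; omega)] at t3
  rw [relSeries_split (n := n) (m := g + 3) (k := a + k) (by omega) _ pathRel
    (lollipopRel k) (by intros; unfold lollipopRel pathRel; omega)
    (by intros; unfold lollipopRel; omega) (by intros; unfold lollipopRel; omega)] at t4
  rw [relSeries_split (n := n) (m := g + 1) (k := a + (k + 2)) (by omega) _ pathRel
    (lollipopRel (k + 2)) (by intros; unfold lollipopRel pathRel; omega)
    (by intros; unfold lollipopRel; omega) (by intros; unfold lollipopRel; omega)] at t5
  rw [relSeries_split (n := n) (m := g + 1) (k := a + (k + 2)) (by omega) _ pathRel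
    (fun i j => lollipopRel (k + 2) i j ∧ ¬ (i = 1 ∧ j = 2))
    (by intros; unfold lollipopRel pathRel; omega)
    (by intros; unfold lollipopRel; omega) (by intros; unfold lollipopRel; omega),
    relSeries_split (n := a + (k + 2)) (m := 2) (k := a + k) (by omega) _ pathRel
    (lollipopRel k) (by intros; unfold lollipopRel pathRel; omega)
    (by intros; unfold lollipopRel; omega) (by intros; unfold lollipopRel; omega)] at t6
  have t2' := relSeries_twin_isolated a k g
  rw [← hn, ← t2', show a + (k + g + 2) + 1 = n by omega, ← five, ← three, ← t2, ← t3, ← t4, ← t5, ← t6]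
  exact colorSum_diamond B hxp.ne hxq.ne hpy.ne hqy.ne fun κ =>
    properInd_twinBase_swap (by omega) κ p q hp hq

/-! ### Splitting compositions near a given partial sum -/

theorem exists_prefix_of_isPartialSum {n m : ℕ} {c : List ℕ} (hc : c ∈ comps n)
    (h : IsPartialSum c m) :
    ∃ A B, c = A ++ B ∧ A ∈ comps m ∧ B ∈ comps (n - m) := by
  obtain ⟨A, B, rfl, rfl⟩ := h
  rw [mem_comps] at hc
  simp only [List.mem_append, List.sum_append] at hc
  refine ⟨A, B, rfl, mem_comps.2 ⟨fun i hi => hc.1 i (Or.inl hi), rfl⟩,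
    mem_comps.2 ⟨fun i hi => hc.1 i (Or.inr hi), by omega⟩⟩

theorem exists_prefix_lastPart_one {n h : ℕ} {c : List ℕ} (hc : c ∈ comps n)
    (h₀ : IsPartialSum c h) (h₁ : IsPartialSum c (h + 1)) :
    ∃ A B, c = A ++ B ∧ A ∈ comps (h + 1) ∧ B ∈ comps (n - (h + 1)) ∧ lastPart A = 1 := by
  obtain ⟨A, B, rfl, hA, hB⟩ := exists_prefix_of_isPartialSum hc h₁
  refine ⟨A, B, rfl, hA, hB, ?_⟩
  have hs := (mem_comps.1 hA).2
  rw [isPartialSum_append_iff (by omega) (mem_comps.1 hB).1] at h₀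
  obtain ⟨C, b, rfl⟩ := List.eq_nil_or_concat' A |>.resolve_left
    (ne_nil_of_mem_comps hA (by omega))
  rw [lastPart_concat]
  have hb := (mem_comps.1 hA).1 b (by simp)
  simp only [List.sum_append, List.sum_singleton] at hs
  by_contra hne
  have := le_of_isPartialSum_append_cons h₀ (by omega)
  omega

open Classical in
theorem sum_isPartialSum_or {M : Type*} [AddCommMonoid M] {n h k : ℕ} (hn : n = h + 1 + k)
    (f : List ℕ → M)
    (hf : ∀ c ∈ comps n, IsPartialSum c h → IsPartialSum c (h + 1) → f c = 0) :
    ∑ c ∈ comps n with (IsPartialSum c h ∨ IsPartialSum c (h + 1)), f c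
      = ∑ A ∈ comps h, ∑ B ∈ comps (k + 1), f (A ++ B)
        + ∑ A ∈ comps (h + 1), ∑ B ∈ comps k, f (A ++ B) := by
  rw [sum_append_comps, sum_append_comps, show h + (k + 1) = n by omega, ← hn, Finset.filter_or,
    ← Finset.sum_union_inter]
  rw [Finset.sum_eq_zero (s := _ ∩ _), add_zero]
  intro c hc
  simp only [Finset.mem_inter, Finset.mem_filter] at hc
  exact hf c hc.1.1 hc.1.2 hc.2.2

open Classical in
theorem sum_isPartialSum_two {M : Type*} [AddCommMonoid M] (h k : ℕ) (f : List ℕ → M) :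
    ∑ c ∈ comps (h + 2 + k) with (¬ IsPartialSum c h ∧ ¬ IsPartialSum c (h + 1)
        ∧ IsPartialSum c (h + 2)), f c
      = ∑ A ∈ comps (h + 2) with 3 ≤ lastPart A, ∑ B ∈ comps k, f (A ++ B) := by
  have h1 := sum_append_comps (h + 2) k
    fun c => if ¬ IsPartialSum c h ∧ ¬ IsPartialSum c (h + 1) then f c else 0
  rw [← Finset.sum_filter, Finset.filter_filter] at h1
  rw [Finset.filter_congr fun c _ => show _ ↔ IsPartialSum c (h + 2) ∧ _ by
    rw [← and_assoc, and_comm], ← h1, Finset.sum_filter]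
  refine Finset.sum_congr rfl fun A hA => ?_
  have hs := (mem_comps.1 hA).2
  by_cases h3 : 3 ≤ lastPart A
  · rw [if_pos h3]
    refine Finset.sum_congr rfl fun B hB => if_pos ?_
    rw [isPartialSum_append_iff (by omega) (mem_comps.1 hB).1,
      isPartialSum_append_iff (by omega) (mem_comps.1 hB).1]
    exact (three_le_lastPart_iff hA).1 h3
  · rw [if_neg h3]
    refine Finset.sum_eq_zero fun B hB => if_neg ?_
    rw [isPartialSum_append_iff (by omega) (mem_comps.1 hB).1,
      isPartialSum_append_iff (by omega) (mem_comps.1 hB).1]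
    exact mt (three_le_lastPart_iff hA).2 h3

open Classical in
theorem sum_comps_split {M : Type*} [AddCommMonoid M] {n h k : ℕ} (hn : n = h + 2 + k)
    (f : List ℕ → M)
    (hf : ∀ c ∈ comps n, IsPartialSum c h → IsPartialSum c (h + 1) → f c = 0) :
    ∑ c ∈ comps n, f c
      = ∑ c ∈ comps n with (¬ IsPartialSum c h ∧ ¬ IsPartialSum c (h + 1)
          ∧ ¬ IsPartialSum c (h + 2)), f c
        + (∑ A ∈ comps h, ∑ B ∈ comps (k + 2), f (A ++ B)
          + ∑ A ∈ comps (h + 1), ∑ B ∈ comps (k + 1), f (A ++ B)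
          + ∑ A ∈ comps (h + 2) with 3 ≤ lastPart A, ∑ B ∈ comps k, f (A ++ B)) := by
  rw [← sum_isPartialSum_or (by omega) f hf, ← sum_isPartialSum_two, ← hn,
    ← Finset.sum_filter_add_sum_filter_not (comps n)
      fun c => IsPartialSum c h ∨ IsPartialSum c (h + 1),
    ← Finset.sum_filter_add_sum_filter_not ((comps n).filter fun c =>
      ¬ (IsPartialSum c h ∨ IsPartialSum c (h + 1))) fun c => IsPartialSum c (h + 2),
    Finset.filter_filter, Finset.filter_filter]
  simp only [not_or, and_assoc]
  abel

theorem we_eq_zero_of_isPartialSum {n h : ℕ} (hh : 0 < h) {c : List ℕ} (hc : c ∈ comps n)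
    (h₀ : IsPartialSum c h) (h₁ : IsPartialSum c (h + 1)) : we c = 0 := by
  obtain ⟨A, B, rfl, hA, -, hl⟩ := exists_prefix_lastPart_one hc h₀ h₁
  rw [we_append (ne_nil_of_mem_comps hA (by omega)), we,
    w_eq_zero_of_lastPart (by have := (mem_comps.1 hA).2; omega) hl, zero_smul, zero_mul]

/-! ### The series `∑ (b - 2) e_b ∑ (c_1 - 1) (c_2 - 1) ⋯ e_C` -/

/-- The sum of `(c_1 - 1) (c_2 - 1) ⋯ e_C` over the compositions `C` of `m` that are empty or have
last part at least `a`. -/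
noncomputable def tailSeries (a m : ℕ) : MvPowerSeries ℕ ℚ :=
  ∑ C ∈ comps m with (C = [] ∨ a ≤ lastPart C), we' C

/-- The sum of `(b - 2) e_b (c_1 - 1) (c_2 - 1) ⋯ e_C` over the compositions `bC` of `m` with `b ≥ 3`
such that `C` is empty or has last part at least `a`. -/
noncomputable def diffSeries (a m : ℕ) : MvPowerSeries ℕ ℚ :=
  ∑ b ∈ Finset.Icc 3 m, ((b : ℚ) - 2) • (elemSymm b * tailSeries a (m - b))

theorem sum_Icc_one_ite {M : Type*} [AddCommMonoid M] (m : ℕ) (F : ℕ → M) :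
    ∑ b ∈ Finset.Icc 1 m, (if 3 ≤ b then F b else 0) = ∑ b ∈ Finset.Icc 3 m, F b := by
  rw [← Finset.sum_filter]
  congr 1
  ext b
  simp only [Finset.mem_filter, Finset.mem_Icc]
  omega

theorem le_lastPart_cons_iff {a m b : ℕ} (ha : a ≤ m) (hb : b ≤ m) {C : List ℕ}
    (hC : C ∈ comps (m - b)) : a ≤ lastPart (b :: C) ↔ (C = [] ∨ a ≤ lastPart C) := by
  by_cases h : C = []
  · subst h
    have := (mem_comps.1 hC).2
    simp only [List.sum_nil] at this
    simp [lastPart_singleton]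
    omega
  · simp [h, lastPart_cons b h]

theorem sum_two_we'_sub_we {a m : ℕ} (ha : 1 ≤ a) (hm : a ≤ m) :
    (2 : ℚ) • (∑ B ∈ comps m with a ≤ lastPart B, we' B) - lollipopSeries a m
      = diffSeries a m - elemSymm 1 * tailSeries a (m - 1) := by
  have h1 : (2 : ℚ) • (∑ B ∈ comps m with a ≤ lastPart B, we' B) - lollipopSeries a m
      = ∑ b ∈ Finset.Icc 1 m, ((b : ℚ) - 2) • (elemSymm b * tailSeries a (m - b)) := by
    unfold lollipopSeries
    rw [Finset.smul_sum, ← Finset.sum_sub_distrib, Finset.sum_filter, sum_comps_cons (by omega)]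
    refine Finset.sum_congr rfl fun b hb => ?_
    rw [Finset.mem_Icc] at hb
    rw [tailSeries, Finset.sum_filter, Finset.mul_sum, Finset.smul_sum]
    refine Finset.sum_congr rfl fun C hC => ?_
    simp only [le_lastPart_cons_iff hm hb.2 hC]
    split_ifs
    · rw [we', we, we', w'_cons, w_cons, elemSymmList_cons, mul_smul_comm, smul_smul, smul_smul,
        ← sub_smul]
      congr 1
      ring
    · simp
  rw [h1, diffSeries, ← Finset.sum_subset (s₁ := insert 1 (Finset.Icc 3 m))]
  · rw [Finset.sum_insert (by simp)]
    push_cast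
    module
  · intro b
    simp only [Finset.mem_insert, Finset.mem_Icc]
    omega
  · intro b hb hb'
    simp only [Finset.mem_insert, Finset.mem_Icc] at hb hb'
    obtain rfl : b = 2 := by omega
    simp

theorem prefix_identity {a m N : ℕ} (ha : 1 ≤ a) (hN : a ≤ N) (hm : 0 < m)
    (𝒜 : Finset (List ℕ)) (h𝒜 : 𝒜 ⊆ comps m) :
    (2 : ℚ) • (∑ A ∈ 𝒜, ∑ B ∈ comps N, if a ≤ lastPart (A ++ B) then we (A ++ B) else 0)
      + elemSymm 1 * (∑ A ∈ 𝒜, ∑ B ∈ comps (N - 1),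
          if a ≤ lastPart (A ++ B) then we (A ++ B) else 0)
      = (∑ A ∈ 𝒜, we A) * lollipopSeries a N + (∑ A ∈ 𝒜, we A) * diffSeries a N := by
  have h1 : ∑ A ∈ 𝒜, ∑ B ∈ comps N, (if a ≤ lastPart (A ++ B) then we (A ++ B) else 0)
      = (∑ A ∈ 𝒜, we A) * ∑ B ∈ comps N with a ≤ lastPart B, we' B := by
    rw [Finset.sum_mul]
    refine Finset.sum_congr rfl fun A hA => ?_
    rw [Finset.sum_filter, Finset.mul_sum]
    refine Finset.sum_congr rfl fun B hB => ?_
    rw [lastPart_append A (ne_nil_of_mem_comps hB (by omega)),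
      we_append (ne_nil_of_mem_comps (h𝒜 hA) hm)]
    split_ifs <;> simp
  have h2 : ∑ A ∈ 𝒜, ∑ B ∈ comps (N - 1), (if a ≤ lastPart (A ++ B) then we (A ++ B) else 0)
      = (∑ A ∈ 𝒜, we A) * tailSeries a (N - 1) := by
    rw [Finset.sum_mul]
    refine Finset.sum_congr rfl fun A hA => ?_
    rw [tailSeries, Finset.sum_filter, Finset.mul_sum]
    refine Finset.sum_congr rfl fun B hB => ?_
    have : a ≤ lastPart (A ++ B) ↔ (B = [] ∨ a ≤ lastPart B) := by
      by_cases h : B = []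
      · subst h
        have h3 := (mem_comps.1 hB).2
        have h4 := lastPart_pos (h𝒜 hA) hm
        simp only [List.sum_nil] at h3
        simp
        omega
      · simp [h, lastPart_append A h]
    simp only [this]
    rw [we_append (ne_nil_of_mem_comps (h𝒜 hA) hm)]
    split_ifs <;> simp
  have h3 := sum_two_we'_sub_we ha hN
  rw [h1, h2, ← sub_add_cancel (diffSeries a N) (elemSymm 1 * tailSeries a (N - 1)), ← h3,
    mul_add, mul_sub, mul_smul_comm]
  ring

theorem sum_we_three_le_lastPart {h : ℕ} (hh : 0 < h) :
    ∑ A ∈ comps (h + 2) with 3 ≤ lastPart A, we A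
      = pathSeries (h + 2) - elemSymm 2 * pathSeries h := by
  rw [eq_sub_iff_add_eq, show pathSeries (h + 2) = ∑ c ∈ comps (h + 2), we c from rfl,
    ← Finset.sum_filter_add_sum_filter_not (comps (h + 2)) (fun A => 3 ≤ lastPart A)]
  congr 1
  rw [Finset.sum_filter, sum_comps_concat (by omega),
    Finset.sum_eq_single_of_mem 2 (by simp)]
  · rw [pathSeries, Finset.mul_sum]
    refine Finset.sum_congr (by simp) fun C hC => ?_
    rw [lastPart_concat, if_pos (by omega), we, we, w_concat (ne_nil_of_mem_comps hC hh),
      elemSymmList_append, elemSymmList_singleton, mul_smul_comm, mul_comm (elemSymm 2)]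
    congr 1
    push_cast
    ring
  · intro b hb hne
    refine Finset.sum_eq_zero fun C hC => ?_
    rw [Finset.mem_Icc] at hb
    rw [lastPart_concat]
    split_ifs with h3
    · rfl
    · obtain rfl : b = 1 := by omega
      rw [we, w_concat (ne_nil_of_mem_comps hC (by omega))]
      simp

open Classical in
/-- The part of the expansion away from the partial sums `h`, `h + 1`, `h + 2`. -/
theorem lollipop_combination {a h k : ℕ} (ha : 1 ≤ a) (hh : 0 < h) :
    (2 : ℚ) • lollipopSeries a (h + 2 + (a + k))
        + elemSymm 1 * lollipopSeries a (h + 2 + (a + k) - 1)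
        - pathSeries (h + 1) * lollipopSeries a (a + k + 1)
        - pathSeries (h + 2) * lollipopSeries a (a + k)
        - pathSeries h * lollipopSeries a (a + k + 2)
        + elemSymm 2 * (pathSeries h * lollipopSeries a (a + k))
      = (2 : ℚ) • (∑ c ∈ comps (h + 2 + (a + k)) with (a ≤ lastPart c ∧ ¬ IsPartialSum c h
            ∧ ¬ IsPartialSum c (h + 1) ∧ ¬ IsPartialSum c (h + 2)), we c)
        + elemSymm 1 * (∑ c ∈ comps (h + 2 + (a + k) - 1) with (a ≤ lastPart c
            ∧ ¬ IsPartialSum c h ∧ ¬ IsPartialSum c (h + 1) ∧ ¬ IsPartialSum c (h + 2)), we c)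
        + (pathSeries h * diffSeries a (a + k + 2) + pathSeries (h + 1) * diffSeries a (a + k + 1))
        + (∑ A ∈ comps (h + 2) with 3 ≤ lastPart A, we A) * diffSeries a (a + k) := by
  let f : List ℕ → MvPowerSeries ℕ ℚ := fun c => if a ≤ lastPart c then we c else 0
  have hf : ∀ n, ∀ c ∈ comps n, IsPartialSum c h → IsPartialSum c (h + 1) → f c = 0 := by
    intro n c hc h₀ h₁
    simp only [f, we_eq_zero_of_isPartialSum hh hc h₀ h₁, ite_self]
  have e1 := sum_comps_split (n := h + 2 + (a + k)) rfl f (hf _)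
  have e2 := sum_comps_split (n := h + 2 + (a + k) - 1) (k := a + k - 1) (by omega) f (hf _)
  rw [show a + k - 1 + 2 = a + k + 2 - 1 by omega, show a + k - 1 + 1 = a + k + 1 - 1 by omega]
    at e2
  have p0 := prefix_identity (N := a + k + 2) ha (by omega) hh (comps h) subset_rfl
  have p1 := prefix_identity (N := a + k + 1) (m := h + 1) ha (by omega) (by omega) _ subset_rfl
  have p2 := prefix_identity (N := a + k) (m := h + 2) ha (by omega) (by omega)
    ((comps (h + 2)).filter fun A => 3 ≤ lastPart A) (Finset.filter_subset _ _)
  have s := sum_we_three_le_lastPart hh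
  simp only [f] at e1 e2
  rw [← Finset.sum_filter, ← Finset.sum_filter, Finset.filter_filter] at e1 e2
  simp only [and_comm (b := a ≤ lastPart _)] at e1 e2
  rw [show lollipopSeries a (h + 2 + (a + k)) = _ from e1,
    show lollipopSeries a (h + 2 + (a + k) - 1) = _ from e2]
  rw [show ∑ A ∈ comps h, we A = pathSeries h from rfl] at p0
  rw [show ∑ A ∈ comps (h + 1), we A = pathSeries (h + 1) from rfl] at p1
  have s' : (∑ A ∈ comps (h + 2) with 3 ≤ lastPart A, we A) * lollipopSeries a (a + k)
      = pathSeries (h + 2) * lollipopSeries a (a + k)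
        - elemSymm 2 * (pathSeries h * lollipopSeries a (a + k)) := by
    rw [s]
    ring
  simp only [smul_add, mul_add]
  linear_combination p0 + p1 + p2 + s'

/-! ### The sums with a prescribed partial sum -/

/-- The summand `(k_{-1} - 2) w_{K \ k_{-1}} e_K`. -/
noncomputable def lastTerm (c : List ℕ) : MvPowerSeries ℕ ℚ :=
  (((lastPart c : ℚ) - 2) * w c.dropLast) • elemSymmList c

theorem lastTerm_append_concat {A : List ℕ} (hA : A ≠ []) (C : List ℕ) (b : ℕ) :
    lastTerm (A ++ (C ++ [b])) = we A * (((b : ℚ) - 2) • (elemSymm b * we' C)) := by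
  rw [lastTerm, ← List.append_assoc, lastPart_concat, List.dropLast_concat, w_append hA,
    elemSymmList_append, elemSymmList_append, elemSymmList_singleton, we, we']
  simp only [mul_smul_comm, smul_mul_assoc, smul_smul]
  congr 1
  · ring
  · ring

/-- The condition on the last two parts in the sum over `(k_{-1} - 2) w_{K \ k_{-1}} e_K`. -/
def LastCond (a M : ℕ) (c : List ℕ) : Prop :=
  3 ≤ lastPart c ∧ (M ≤ lastPart c + lastPart c.dropLast ∨ a ≤ lastPart c.dropLast)

open Classical in
theorem sum_lastTerm_append {a m N M : ℕ} (hN : 0 < N) (hm : 0 < m) (hM : N < M)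
    {A : List ℕ} (hA : A ∈ comps m) (hA' : M ≤ N + lastPart A ∨ w A = 0) :
    ∑ B ∈ comps N, (if LastCond a M (A ++ B) then lastTerm (A ++ B) else 0)
      = we A * diffSeries a N := by
  have hne := ne_nil_of_mem_comps hA hm
  rw [diffSeries, ← sum_Icc_one_ite, sum_comps_concat hN, Finset.mul_sum]
  refine Finset.sum_congr rfl fun b hb => ?_
  rw [Finset.mem_Icc] at hb
  have hsplit : (if 3 ≤ b then ((b : ℚ) - 2) • (elemSymm b * tailSeries a (N - b)) else 0)
      = ∑ C ∈ comps (N - b), if 3 ≤ b ∧ (C = [] ∨ a ≤ lastPart C) then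
        ((b : ℚ) - 2) • (elemSymm b * we' C) else 0 := by
    split_ifs with h3
    · rw [tailSeries, Finset.sum_filter, Finset.mul_sum, Finset.smul_sum]
      refine Finset.sum_congr rfl fun C _ => ?_
      simp only [h3, true_and]
      split_ifs <;> simp
    · simp [h3]
  rw [hsplit, Finset.mul_sum]
  refine Finset.sum_congr rfl fun C hC => ?_
  by_cases hw : w A = 0
  · rw [lastTerm_append_concat hne, we, hw]
    simp
  have hcond : LastCond a M (A ++ (C ++ [b])) ↔ 3 ≤ b ∧ (C = [] ∨ a ≤ lastPart C) := by
    rw [LastCond, ← List.append_assoc, lastPart_concat, List.dropLast_concat]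
    have hs := (mem_comps.1 hC).2
    by_cases h : C = []
    · subst h
      have := hA'.resolve_right hw
      simp only [List.sum_nil] at hs
      simp only [List.append_nil, true_or, and_true, and_iff_left_iff_imp]
      intro _
      left
      omega
    · have := lastPart_le_sum C
      rw [lastPart_append A h]
      simp only [h, false_or]
      omega
  simp only [hcond]
  split_ifs
  · exact lastTerm_append_concat hne C b
  · simp

open Classical in
theorem sum_lastTerm {a h k : ℕ} (ha : 1 ≤ a) (hh : 0 < h) :
    ∑ c ∈ comps (h + 2 + (a + k)) with ((IsPartialSum c h ∨ IsPartialSum c (h + 1))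
        ∧ LastCond a (a + k + 3) c), lastTerm c
      = pathSeries h * diffSeries a (a + k + 2)
        + pathSeries (h + 1) * diffSeries a (a + k + 1) := by
  rw [← Finset.filter_filter, Finset.sum_filter, sum_isPartialSum_or (k := a + k + 1) (by omega)]
  · rw [pathSeries, pathSeries, Finset.sum_mul, Finset.sum_mul]
    congr 1
    · refine Finset.sum_congr rfl fun A hA => ?_
      have := lastPart_pos hA hh
      exact sum_lastTerm_append (by omega) hh (by omega) hA (Or.inl (by omega))
    · refine Finset.sum_congr rfl fun A hA => ?_
      have := lastPart_pos hA (by omega)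
      refine sum_lastTerm_append (by omega) (by omega) (by omega) hA ?_
      by_cases h1 : lastPart A = 1
      · exact Or.inr (w_eq_zero_of_lastPart (by have := (mem_comps.1 hA).2; omega) h1)
      · exact Or.inl (by omega)
  · intro c hc h₀ h₁
    obtain ⟨A, B, rfl, hA, hB, hl⟩ := exists_prefix_lastPart_one hc h₀ h₁
    obtain ⟨C, b, rfl⟩ := List.eq_nil_or_concat' B |>.resolve_left
      (ne_nil_of_mem_comps hB (by omega))
    rw [lastTerm_append_concat (ne_nil_of_mem_comps hA (by omega)), we,
      w_eq_zero_of_lastPart (by have := (mem_comps.1 hA).2; omega) hl]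
    simp

/-- `Θ` for lists. -/
noncomputable def listΘ (c : List ℕ) (s : ℕ) : ℕ :=
  sInf {t | IsPartialSum c t ∧ s ≤ t} - s

theorem Θ_eq_listΘ {n : ℕ} (K : Composition n) (s : ℕ) : Θ K s = listΘ K.blocks s := by
  unfold Θ σ listΘ
  congr 2
  ext t
  simp only [Set.mem_ofPred_eq, isPartialSum_iff]
  constructor
  · rintro ⟨k, h1, h2, h3⟩
    exact ⟨⟨k, h1, h2⟩, h3⟩
  · rintro ⟨⟨k, h1, h2⟩, h3⟩
    exact ⟨k, h1, h2, h3⟩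

theorem listΘ_append_cons {n : ℕ} {A C : List ℕ} {b : ℕ} (hc : A ++ b :: C ∈ comps n) :
    listΘ (A ++ b :: C) (A.sum + 1) = b - 1 := by
  obtain ⟨K, -, hK⟩ := Finset.mem_image.1 hc
  rw [← hK, ← Θ_eq_listΘ, Θ_after_prefix K hK]

/-- The summand `(t - 1) / t · w_K e_K`, where `t = Θ_K(s)`. -/
noncomputable def ΘTerm (s : ℕ) (c : List ℕ) : MvPowerSeries ℕ ℚ :=
  (((listΘ c s : ℚ) - 1) / (listΘ c s : ℚ) * w c) • elemSymmList c

open Classical in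
theorem sum_ΘTerm {a h k : ℕ} (ha : 1 ≤ a) :
    ∑ c ∈ comps (h + 2 + (a + k)) with ((¬ IsPartialSum c h ∧ ¬ IsPartialSum c (h + 1)
        ∧ IsPartialSum c (h + 2)) ∧ a ≤ lastPart c ∧ 2 ≤ listΘ c (h + 3)), ΘTerm (h + 3) c
      = (∑ A ∈ comps (h + 2) with 3 ≤ lastPart A, we A) * diffSeries a (a + k) := by
  rw [← Finset.filter_filter, Finset.sum_filter, sum_isPartialSum_two, Finset.sum_mul]
  refine Finset.sum_congr rfl fun A hA => ?_
  replace hA := (Finset.mem_filter.1 hA).1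
  have hne := ne_nil_of_mem_comps hA (by omega)
  rw [diffSeries, ← sum_Icc_one_ite, sum_comps_cons (by omega), Finset.mul_sum]
  refine Finset.sum_congr rfl fun b hb => ?_
  rw [Finset.mem_Icc] at hb
  have hΘ : ∀ C ∈ comps (a + k - b), listΘ (A ++ b :: C) (h + 3) = b - 1 := by
    intro C hC
    have h1 : b :: C ∈ comps (a + k) := by
      rw [mem_comps] at hC ⊢
      refine ⟨fun i hi => ?_, by simp [hC.2]; omega⟩
      rcases List.mem_cons.1 hi with rfl | hi
      exacts [hb.1, hC.1 i hi]
    have := listΘ_append_cons (append_mem_comps hA h1)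
    rwa [(mem_comps.1 hA).2] at this
  split_ifs with h3
  · rw [tailSeries, Finset.sum_filter, Finset.mul_sum, Finset.smul_sum, Finset.mul_sum]
    refine Finset.sum_congr rfl fun C hC => ?_
    rw [hΘ C hC, lastPart_append A (List.cons_ne_nil b C)]
    simp only [le_lastPart_cons_iff (by omega : a ≤ a + k) hb.2 hC, show 2 ≤ b - 1 by omega,
      and_true]
    split_ifs
    · rw [ΘTerm, hΘ C hC, w_append hne, w'_cons, elemSymmList_append, elemSymmList_cons, we, we',
        Nat.cast_sub hb.1]
      simp only [mul_smul_comm, smul_mul_assoc, smul_smul]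
      congr 1
      have : (b : ℚ) - 1 ≠ 0 := by
        have : (3 : ℚ) ≤ b := by exact_mod_cast h3
        linarith
      push_cast
      field_simp
      ring
    · simp
  · rw [mul_zero]
    refine Finset.sum_eq_zero fun C hC => if_neg ?_
    rw [hΘ C hC]
    omega

/-- The chromatic symmetric function of the twinned lollipop in terms of those of smaller lollipops
and paths. -/
theorem chromaticSymm_twinnedLollipop_eq {a h k : ℕ} (ha : 1 ≤ a) (hh : 0 < h)
    (hl : h < k + h + 1) :
    (2 * ((a - 1)! : ℚ))⁻¹ • chromaticSymm (twinnedLollipop a (k + h + 1) h hl)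
      = (2 : ℚ) • lollipopSeries a (h + 2 + (a + k))
        + elemSymm 1 * lollipopSeries a (h + 2 + (a + k) - 1)
        - pathSeries (h + 1) * lollipopSeries a (a + k + 1)
        - pathSeries (h + 2) * lollipopSeries a (a + k)
        - pathSeries h * lollipopSeries a (a + k + 2)
        + elemSymm 2 * (pathSeries h * lollipopSeries a (a + k)) := by
  obtain ⟨g, rfl⟩ : ∃ g, h = g + 1 := ⟨h - 1, by omega⟩
  have h2 : relSeries 2 pathRel = (2 : ℚ) • elemSymm 2 := by
    have := relSeries_complete 2
    rw [Nat.factorial_two, Nat.cast_ofNat] at this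
    rw [← this]
    apply relSeries_congr
    intro i j hij hj
    simp only [pathRel, iff_true]
    omega
  have h1 : relSeries 1 (fun _ _ => True) = elemSymm 1 := by
    simpa using relSeries_complete 1
  have hc : ((a - 1)! : ℚ) ≠ 0 := by
    exact_mod_cast Nat.factorial_ne_zero _
  rw [chromaticSymm_twinnedLollipop, show a + (k + (g + 1) + 1) + 1 = a + (k + g + 3) by omega,
    show k + (g + 1) + 1 + 1 = k + g + 3 by omega, relSeries_twinRel ha, h1, h2]
  rw [relSeries_path (m := g + 1) (by omega), relSeries_path (m := g + 2) (by omega),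
    relSeries_path (m := g + 3) (by omega)]
  simp only [relSeries_lollipop _ ha]
  rw [show g + 1 + 2 + (a + k) = a + (k + g + 3) by omega,
    show a + (k + g + 3) - 1 = a + (k + g + 2) by omega]
  rw [inv_smul_eq_iff₀ (mul_ne_zero two_ne_zero hc)]
  simp only [mul_smul_comm, smul_mul_assoc, ← add_assoc]
  rw [mul_left_comm (elemSymm 2)]
  module

end TwinnedLollipop

open TwinnedLollipop
theorem mainTheorem4 (a l h n : ℕ) (ha : 1 ≤ a) (hl : 2 ≤ l) (hn : n = a + l + 1)
    (h1 : 1 ≤ h) (h2 : h ≤ l - 1) :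
    (2 * ((a - 1)! : ℚ))⁻¹ • chromaticSymm (twinnedLollipop a l h (by omega)) =
        (∑ K : Composition n with a ≤ last K 1 ∧ 3 ≤ Θ K h,
            (2 * w K.blocks) • elemSymmList K.blocks)
        + (∑ I : Composition (n - 1) with a ≤ last I 1 ∧ 3 ≤ Θ I h,
            w I.blocks • elemSymmList (1 :: I.blocks))
        + (∑ K : Composition n with Θ K h ≤ 1 ∧ 3 ≤ last K 1 ∧
              (n - h + 1 ≤ last K 1 + last K 2 ∨ a ≤ last K 2),
            (((last K 1 : ℚ) - 2) * w K.blocks.dropLast) • elemSymmList K.blocks)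
        + (∑ K : Composition n with a ≤ last K 1 ∧ Θ K h = 2 ∧ 2 ≤ Θ K (h + 3),
            (((Θ K (h + 3) : ℚ) - 1) / (Θ K (h + 3) : ℚ) * w K.blocks) • elemSymmList K.blocks)
    ∧ (∀ (m : ℕ) (K : Composition m), 0 ≤ w K.blocks)
    ∧ (∀ K : Composition n, 3 ≤ last K 1 →
        0 ≤ ((last K 1 : ℚ) - 2) * w K.blocks.dropLast)
    ∧ (∀ K : Composition n, 2 ≤ Θ K (h + 3) →
        0 ≤ ((Θ K (h + 3) : ℚ) - 1) / (Θ K (h + 3) : ℚ) * w K.blocks) := by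
  classical
  have hw : ∀ (m : ℕ) (K : Composition m), 0 ≤ w K.blocks :=
    fun m K => w_nonneg fun i hi => K.blocks_pos hi
  refine ⟨?_, hw, fun K hK => ?_, fun K hK => ?_⟩
  · obtain ⟨k, rfl⟩ : ∃ k, l = k + h + 1 := ⟨l - h - 1, by omega⟩
    obtain rfl : n = h + 2 + (a + k) := by omega
    rw [chromaticSymm_twinnedLollipop_eq ha h1, lollipop_combination ha h1, ← sum_lastTerm ha h1,
      ← sum_ΘTerm ha]
    congr 1
    · congr 1
      · congr 1
        · rw [Finset.smul_sum, ← sum_composition_filter _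
            (fun K : Composition (h + 2 + (a + k)) => a ≤ last K 1 ∧ 3 ≤ Θ K h)]
          · refine Finset.sum_congr rfl fun K _ => ?_
            rw [we, smul_smul]
          · intro K
            rw [last_one, three_le_Θ_iff K (by omega)]
        · rw [Finset.mul_sum, ← sum_composition_filter _
            (fun K : Composition (h + 2 + (a + k) - 1) => a ≤ last K 1 ∧ 3 ≤ Θ K h)]
          · refine Finset.sum_congr rfl fun K _ => ?_
            rw [we, mul_smul_comm, elemSymmList_cons]
          · intro K
            rw [last_one, three_le_Θ_iff K (by omega)]
      · rw [← sum_composition_filter _ (fun K : Composition (h + 2 + (a + k)) =>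
          Θ K h ≤ 1 ∧ 3 ≤ last K 1 ∧
              (h + 2 + (a + k) - h + 1 ≤ last K 1 + last K 2 ∨ a ≤ last K 2))]
        · refine Finset.sum_congr rfl fun K _ => ?_
          rw [lastTerm, last_one]
        · intro K
          rw [last_one, last_two, Θ_le_one_iff K (by omega), LastCond,
            show h + 2 + (a + k) - h + 1 = a + k + 3 by omega]
    · rw [← sum_composition_filter _ (fun K : Composition (h + 2 + (a + k)) =>
          a ≤ last K 1 ∧ Θ K h = 2 ∧ 2 ≤ Θ K (h + 3))]
      · refine Finset.sum_congr rfl fun K _ => ?_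
        rw [ΘTerm, Θ_eq_listΘ]
      · intro K
        rw [last_one, Θ_eq_two_iff K (by omega), Θ_eq_listΘ]
        tauto
  · have h3 : (3 : ℚ) ≤ last K 1 := by exact_mod_cast hK
    exact mul_nonneg (by linarith)
      (w_nonneg fun i hi => K.blocks_pos (List.dropLast_subset _ hi))
  · have h3 : (2 : ℚ) ≤ Θ K (h + 3) := by exact_mod_cast hK
    exact mul_nonneg (div_nonneg (by linarith) (by linarith)) (hw n K)
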